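/- Let $\Omega=(a_1,b_1)\times(a_2,b_2)\times(a_3,b_3)\subset\mathbb{R}^3$ with $a_i<b_i$, and let $\alpha>0$ with $\alpha\neq m+\tfrac12$ for every integer $m\ge 0$. Write $n=\lfloor\alpha\rfloor+1$. For $\varphi\in C_0^\infty(\Omega)$ (real-valued, smooth, with compact support in $\Omega$), $x\in\Omega$ and $i=1,2,3$, let $\varphi^{(i)}(x,t)$ be the value of $\varphi$ at the point $x$ with its $i$-th coordinate replaced by $t$, and define the left and right Riemann–Liouville derivatives $$\frac{\partial^\alpha \varphi(x)}{\partial x_i^\alpha}=\frac{1}{\Gamma(n-\alpha)}\Big(\frac{d}{dx_i}\Big)^{n}\int_{a_i}^{x_i}\frac{\varphi^{(i)}(x,t)}{(x_i-t)^{\alpha-\lfloor\alpha\rfloor}}\,dt,\qquad \frac{\partial^{\alpha*} \varphi(x)}{\partial x_i^{\alpha*}}=\frac{1}{\Gamma(n-\alpha)}\Big(-\frac{d}{dx_i}\Big)^{n}\int_{x_i}^{b_i}\frac{\varphi^{(i)}(x,t)}{(t-x_i)^{\alpha-\lfloor\alpha\rfloor}}\,dt,$$ and $\nabla^\alpha\varphi=(\partial^\alpha\varphi/\partial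 x_i^\alpha)_{i=1}^3$, $\nabla^{\alpha*}\varphi=(\partial^{\alpha*}\varphi/\partial x_i^{\alpha*})_{i=1}^3$. Define the norms $$\|\varphi\|_{F^\alpha_L}^2=\|\varphi\|_{L^2(\Omega)}^2+\int_\Omega\|\nabla^\alpha\varphi\|^2dx,\quad \|\varphi\|_{F^\alpha_R}^2=\|\varphi\|_{L^2(\Omega)}^2+\int_\Omega\|\nabla^{\alpha*}\varphi\|^2dx,\quad \|\varphi\|_{H^\alpha}^2=\|\varphi\|_{L^2(\Omega)}^2+\int_{\mathbb{R}^3}\|\xi\|^{2\alpha}|\widehat\varphi(\xi)|^2d\xi,$$ where $\widehat\varphi(\xi)=(2\pi)^{-3/2}\int_{\mathbb{R}^3}\varphi(x)e^{-ix\cdot\xi}dx$ and $\varphi$ is extended by zero outside $\Omega$. Let $F^\alpha_{L,0}(\Omega)$, $F^\alpha_{R,0}(\Omega)$ and $H^\alpha_0(\Omega)$ be the closures (completions) of $C_0^\infty(\Omega)$ under these three norms, each with its canonical map to $L^2(\Omega)$. Then the three canonical maps to $L^2(\Omega)$ are injective, so that the three closures are spaces of $L^2(\Omega)$ functions, and $$F^\alpha_{L,0}(\Omega)=F^\alpha_{R,0}(\Omega)=H^\alpha_0(\Omega)$$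 as sets of functions, with equivalent norms: there are constants $c,C>0$ such that $c\|u\|_{H^\alpha}\le\|u\|_{F^\alpha_L}\le C\|u\|_{H^\alpha}$ for every $u$ in this space, and likewise with $F^\alpha_R$ in place of $F^\alpha_L$. -/

import Mathlib

open MeasureTheory Distributions
open scoped ContDiff Convolution

noncomputable section

namespace FracSobolev

/-- Three-dimensional Euclidean space. -/
abbrev E3 : Type := EuclideanSpace ℝ (Fin 3)

/-- The open box `(a₁,b₁) × (a₂,b₂) × (a₃,b₃)`. -/
def box (a b : Fin 3 → ℝ) : TopologicalSpace.Opens E3 where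
  carrier := {x | ∀ i, x i ∈ Set.Ioo (a i) (b i)}
  is_open' := by
    simp only [Set.ofPred_forall]
    exact isOpen_iInter_of_finite fun i => isOpen_Ioo.preimage (by fun_prop)

/-- The point `x` with its `i`-th coordinate replaced by `t`. -/
def subst (x : E3) (i : Fin 3) (t : ℝ) : E3 := WithLp.toLp 2 (Function.update x.ofLp i t)

/-- Left Riemann–Liouville partial derivative of order `α` in the `i`-th variable,
with base point `a i`. -/
def leftRL (a : Fin 3 → ℝ) (α : ℝ) (f : E3 → ℝ) (i : Fin 3) (x : E3) : ℝ :=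
  1 / Real.Gamma (⌊α⌋₊ + 1 - α) *
    iteratedDeriv (⌊α⌋₊ + 1)
      (fun s : ℝ => ∫ t in (a i)..s, f (subst x i t) / (s - t) ^ (α - ⌊α⌋₊)) (x i)

/-- Right Riemann–Liouville partial derivative of order `α` in the `i`-th variable,
with end point `b i`. -/
def rightRL (b : Fin 3 → ℝ) (α : ℝ) (f : E3 → ℝ) (i : Fin 3) (x : E3) : ℝ :=
  1 / Real.Gamma (⌊α⌋₊ + 1 - α) * ((-1) ^ (⌊α⌋₊ + 1) *
    iteratedDeriv (⌊α⌋₊ + 1)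
      (fun s : ℝ => ∫ t in s..(b i), f (subst x i t) / (t - s) ^ (α - ⌊α⌋₊)) (x i))

/-- The left fractional gradient. -/
def leftGrad (a : Fin 3 → ℝ) (α : ℝ) (f : E3 → ℝ) (x : E3) : E3 :=
  WithLp.toLp 2 fun i => leftRL a α f i x

/-- The right fractional gradient. -/
def rightGrad (b : Fin 3 → ℝ) (α : ℝ) (f : E3 → ℝ) (x : E3) : E3 :=
  WithLp.toLp 2 fun i => rightRL b α f i x

/-- The Fourier transform `û(ξ) = (2π)^{-3/2} ∫ u(x) e^{-i x·ξ} dx`. -/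
def fourier (u : E3 → ℝ) (ξ : E3) : ℂ :=
  ((2 * Real.pi) ^ (-(3 / 2 : ℝ)) : ℝ) *
    ∫ x : E3, (u x : ℂ) * Complex.exp (-(Complex.I * (inner ℝ x ξ : ℝ)))

/-- The `L²` norm of a function with respect to a measure. -/
def l2norm {X W : Type*} [MeasurableSpace X] [NormedAddCommGroup W] (μ : Measure X)
    (f : X → W) : ℝ :=
  Real.sqrt (∫ x, ‖f x‖ ^ 2 ∂μ)

/-! ### Square integrability of the fractional gradients of test functions -/

section L2

variable {X W : Type*} [MeasurableSpace X] [NormedAddCommGroup W]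
  {μ : Measure X}

theorem l2norm_eq_toReal {f : X → W} (hf : MemLp f 2 μ) :
    l2norm μ f = (eLpNorm f 2 μ).toReal := by
  have h := hf.eLpNorm_eq_integral_rpow_norm (by norm_num) (by norm_num)
  rw [h, ENNReal.toReal_ofReal (by positivity), l2norm, Real.sqrt_eq_rpow]
  norm_num

theorem l2norm_congr {f g : X → W} (h : f =ᵐ[μ] g) : l2norm μ f = l2norm μ g := by
  unfold l2norm
  congr 1
  exact integral_congr_ae (h.mono fun x hx => by simp [hx])

theorem l2norm_add_le {f g : X → W} (hf : MemLp f 2 μ) (hg : MemLp g 2 μ) :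
    l2norm μ (f + g) ≤ l2norm μ f + l2norm μ g := by
  rw [l2norm_eq_toReal hf, l2norm_eq_toReal hg, l2norm_eq_toReal (hf.add hg),
    ← ENNReal.toReal_add hf.eLpNorm_ne_top hg.eLpNorm_ne_top]
  exact ENNReal.toReal_mono (ENNReal.add_ne_top.2 ⟨hf.eLpNorm_ne_top, hg.eLpNorm_ne_top⟩)
    (eLpNorm_add_le hf.1 hg.1 (by norm_num))

theorem l2norm_smul [NormedSpace ℝ W] (c : ℝ) (f : X → W) : l2norm μ (c • f) = ‖c‖ * l2norm μ f := by
  unfold l2norm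
  simp only [Pi.smul_apply, norm_smul, mul_pow]
  rw [integral_const_mul, Real.sqrt_mul (by positivity), Real.sqrt_sq (norm_nonneg c)]

end L2

theorem continuous_subst (i : Fin 3) : Continuous fun p : E3 × ℝ => subst p.1 i p.2 := by
  unfold subst
  fun_prop

theorem subst_apply_same (x : E3) (i : Fin 3) (t : ℝ) : subst x i t i = t := by
  simp [subst]

theorem subst_eq (x : E3) (i : Fin 3) (t : ℝ) :
    subst x i t = subst x i 0 + t • EuclideanSpace.single i (1 : ℝ) := by
  ext j
  by_cases h : j = i
  · subst h; simp [subst]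
  · simp [subst, h]

theorem hasDerivAt_subst (x : E3) (i : Fin 3) (t : ℝ) :
    HasDerivAt (fun s => subst x i s) (EuclideanSpace.single i (1 : ℝ)) t := by
  have h : (fun s => subst x i s) =
      fun s => subst x i 0 + s • EuclideanSpace.single i (1 : ℝ) :=
    funext fun s => subst_eq x i s
  rw [h]
  simpa using ((hasDerivAt_id t).smul_const (EuclideanSpace.single i (1 : ℝ))).const_add
    (subst x i 0)

theorem contDiff_slice {φ : E3 → ℝ} (h : ContDiff ℝ ∞ φ) (x : E3) (i : Fin 3) :
    ContDiff ℝ ∞ fun t => φ (subst x i t) := by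
  have h2 : (fun s => subst x i s) =
      fun s => subst x i 0 + s • EuclideanSpace.single i (1 : ℝ) :=
    funext fun s => subst_eq x i s
  have h3 : ContDiff ℝ ∞ fun s => subst x i s := by
    rw [h2]
    fun_prop
  exact h.comp h3

theorem norm_coord_le_norm_subst (x : E3) (i : Fin 3) (t : ℝ) : |t| ≤ ‖subst x i t‖ := by
  have := PiLp.norm_apply_le (subst x i t) i
  rwa [subst_apply_same] at this

theorem exists_radius {φ : E3 → ℝ} (h : HasCompactSupport φ) :
    ∃ R : ℝ, ∀ x i t, φ (subst x i t) ≠ 0 → |t| ≤ R := by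
  obtain ⟨R, hR⟩ := h.isCompact.isBounded.exists_norm_le
  exact ⟨R, fun x i t ht =>
    (norm_coord_le_norm_subst x i t).trans (hR _ (subset_tsupport _ ht))⟩

theorem hasCompactSupport_slice {φ : E3 → ℝ} (h : HasCompactSupport φ) (x : E3) (i : Fin 3) :
    HasCompactSupport fun t => φ (subst x i t) := by
  obtain ⟨R, hR⟩ := exists_radius h
  refine HasCompactSupport.of_support_subset_isCompact (K := Set.Icc (-R) R) isCompact_Icc ?_
  intro t ht
  exact abs_le.1 (hR x i t ht)

theorem exists_iteratedDeriv_slice (i : Fin 3) (n : ℕ) : ∀ φ : E3 → ℝ, ContDiff ℝ ∞ φ →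
    HasCompactSupport φ → ∃ ψ : E3 → ℝ, ContDiff ℝ ∞ ψ ∧ HasCompactSupport ψ ∧
      ∀ x t, iteratedDeriv n (fun s => φ (subst x i s)) t = ψ (subst x i t) := by
  induction n with
  | zero => exact fun φ h1 h2 => ⟨φ, h1, h2, fun x t => by simp⟩
  | succ n ih =>
    intro φ h1 h2
    obtain ⟨ψ, k1, k2, k3⟩ := ih (fun y => fderiv ℝ φ y (EuclideanSpace.single i 1))
      ((h1.fderiv_right (m := ∞) (by simp)).clm_apply contDiff_const)
      (h2.fderiv_apply ℝ _)
    refine ⟨ψ, k1, k2, fun x t => ?_⟩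
    rw [iteratedDeriv_succ', ← k3]
    congr 1
    funext s
    exact (((h1.differentiable (by simp)) _).hasFDerivAt.comp_hasDerivAt s
      (hasDerivAt_subst x i s)).deriv

/-- The one-sided kernel `s ↦ s₊^{-β}`. -/
def kern (β : ℝ) : ℝ → ℝ := (Set.Ioi 0).indicator fun s => 1 / s ^ β

theorem measurable_kern (β : ℝ) : Measurable (kern β) :=
  Measurable.indicator (by fun_prop) measurableSet_Ioi

theorem locallyIntegrable_kern {β : ℝ} (hβ : β < 1) : LocallyIntegrable (kern β) := by
  rw [locallyIntegrable_iff]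
  intro K hK
  obtain ⟨R, hR⟩ := hK.isBounded.exists_norm_le
  have h1 : IntervalIntegrable (fun s : ℝ => s ^ (-β)) volume 0 (max R 0) :=
    intervalIntegral.intervalIntegrable_rpow' (by linarith)
  rw [intervalIntegrable_iff_integrableOn_Ioc_of_le (le_max_right _ _)] at h1
  unfold kern
  rw [integrableOn_indicator_iff measurableSet_Ioi]
  refine (h1.congr_fun (g := fun s : ℝ => 1 / s ^ β) (fun s hs => ?_)
    measurableSet_Ioc).mono_set ?_
  · simp [Real.rpow_neg hs.1.le]
  · rintro s ⟨hs0, hs⟩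
    refine ⟨hs0, le_max_of_le_left ?_⟩
    exact (le_abs_self s).trans (hR s hs)

theorem locallyIntegrable_kern_neg {β : ℝ} (hβ : β < 1) :
    LocallyIntegrable fun s => kern β (-s) := by
  rw [locallyIntegrable_iff]
  intro K hK
  have := (locallyIntegrable_iff.1 (locallyIntegrable_kern hβ)) (-K) hK.neg
  have h2 := this.comp_neg
  simpa using h2

theorem floor_frac_lt_one (α : ℝ) : α - ⌊α⌋₊ < 1 := by
  have := Nat.lt_floor_add_one α
  linarith

theorem iteratedDeriv_convolution {k : ℝ → ℝ} (hk : LocallyIntegrable k) (n : ℕ) :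
    ∀ g : ℝ → ℝ, ContDiff ℝ ∞ g → HasCompactSupport g →
      iteratedDeriv n (k ⋆ g) = k ⋆ (iteratedDeriv n g) := by
  induction n with
  | zero => intro g _ _; simp
  | succ n ih =>
    intro g h1 h2
    rw [iteratedDeriv_succ', iteratedDeriv_succ', ← ih (deriv g) _ h2.deriv]
    · congr 1
      funext x
      exact (h2.hasDerivAt_convolution_right _ hk (h1.of_le (by simp)) x).deriv
    · exact ((contDiff_infty_iff_deriv).1 h1).2

/-- Partial convolution in the `i`-th variable followed by `n` derivatives. -/
def convDeriv (k : ℝ → ℝ) (n : ℕ) (i : Fin 3) (φ : E3 → ℝ) (x : E3) : ℝ :=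
  iteratedDeriv n (k ⋆ fun t => φ (subst x i t)) (x i)

section conv

variable {k : ℝ → ℝ} {n : ℕ} {i : Fin 3} {φ ψ : E3 → ℝ}

theorem contDiff_conv (hk : LocallyIntegrable k) (hφ : ContDiff ℝ ∞ φ) (cφ : HasCompactSupport φ) (x : E3) :
    ContDiff ℝ ∞ (k ⋆ fun t => φ (subst x i t)) :=
  (hasCompactSupport_slice cφ x i).contDiff_convolution_right _ hk (contDiff_slice hφ x i)

theorem convDeriv_add (hk : LocallyIntegrable k) (hφ : ContDiff ℝ ∞ φ) (cφ : HasCompactSupport φ)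
    (hψ : ContDiff ℝ ∞ ψ) (cψ : HasCompactSupport ψ) (x : E3) :
    convDeriv k n i (φ + ψ) x = convDeriv k n i φ x + convDeriv k n i ψ x := by
  unfold convDeriv
  have e1 := (hasCompactSupport_slice cφ x i).convolutionExists_right
    (ContinuousLinearMap.lsmul ℝ ℝ) hk (contDiff_slice hφ x i).continuous
  have e2 := (hasCompactSupport_slice cψ x i).convolutionExists_right
    (ContinuousLinearMap.lsmul ℝ ℝ) hk (contDiff_slice hψ x i).continuous
  have : (k ⋆ fun t => (φ + ψ) (subst x i t)) =
      (k ⋆ fun t => φ (subst x i t)) + (k ⋆ fun t => ψ (subst x i t)) :=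
    e1.distrib_add e2
  rw [this]
  exact iteratedDeriv_add
    ((contDiff_conv hk hφ cφ x).contDiffAt.of_le (by exact_mod_cast le_top))
    ((contDiff_conv hk hψ cψ x).contDiffAt.of_le (by exact_mod_cast le_top))

theorem convDeriv_smul (hk : LocallyIntegrable k) (hφ : ContDiff ℝ ∞ φ) (cφ : HasCompactSupport φ) (c : ℝ) (x : E3) :
    convDeriv k n i (c • φ) x = c * convDeriv k n i φ x := by
  unfold convDeriv
  have : (k ⋆ fun t => (c • φ) (subst x i t)) = c • (k ⋆ fun t => φ (subst x i t)) := by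
    rw [← convolution_smul]; rfl
  rw [this]
  exact iteratedDeriv_const_smul
    ((contDiff_conv hk hφ cφ x).contDiffAt.of_le (by exact_mod_cast le_top)) c

theorem memLp_convDeriv (hk : LocallyIntegrable k) (mk : Measurable k) (hφ : ContDiff ℝ ∞ φ) (cφ : HasCompactSupport φ)
    (a b : Fin 3 → ℝ) :
    MemLp (convDeriv k n i φ) 2 (volume.restrict (box a b : Set E3)) := by
  obtain ⟨ψ, p1, p2, p3⟩ := exists_iteratedDeriv_slice i n φ hφ cφ
  have e : convDeriv k n i φ = fun x => ∫ s, k s * ψ (subst x i (x i - s)) := by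
    funext x
    unfold convDeriv
    rw [iteratedDeriv_convolution hk n _ (contDiff_slice hφ x i) (hasCompactSupport_slice cφ x i)]
    simp only [convolution, p3]
    rfl
  have hsub : (box a b : Set E3) ⊆ (EuclideanSpace.equiv (Fin 3) ℝ) ⁻¹'
      (Set.univ.pi fun i => Set.Icc (a i) (b i)) := by
    intro x hx j _
    exact Set.Ioo_subset_Icc_self (hx j)
  have hK : IsCompact ((EuclideanSpace.equiv (Fin 3) ℝ) ⁻¹'
      (Set.univ.pi fun i => Set.Icc (a i) (b i))) :=
    (EuclideanSpace.equiv (Fin 3) ℝ).toHomeomorph.isCompact_preimage.2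
      (isCompact_univ_pi fun i => isCompact_Icc)
  have hfin : volume (box a b : Set E3) < ⊤ :=
    (measure_mono hsub).trans_lt hK.measure_lt_top
  have : IsFiniteMeasure (volume.restrict (box a b : Set E3)) :=
    ⟨by simpa using hfin⟩
  obtain ⟨M, hM⟩ := p1.continuous.bounded_above_of_compact_support p2
  obtain ⟨R, hR⟩ := exists_radius p2
  set R' : ℝ := R + max |a i| |b i| with hR'
  have hint : IntegrableOn k (Set.Icc (-R') R') :=
    (locallyIntegrable_iff.1 hk) _ isCompact_Icc
  rw [e]
  refine MemLp.of_bound (C := ∫ s in Set.Icc (-R') R', ‖k s‖ * M) ?_ ?_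
  · refine StronglyMeasurable.aestronglyMeasurable ?_
    refine StronglyMeasurable.integral_prod_right
      (f := fun (x : E3) (s : ℝ) => k s * ψ (subst x i (x i - s))) ?_
    refine ((mk.comp measurable_snd).mul ?_).stronglyMeasurable
    refine Continuous.measurable (p1.continuous.comp ?_)
    exact (continuous_subst i).comp (f := fun p : E3 × ℝ => (p.1, p.1 i - p.2)) (by fun_prop)
  · refine (ae_restrict_mem (box a b).isOpen.measurableSet).mono fun x hx => ?_
    have hz : ∀ s, s ∉ Set.Icc (-R') R' → k s * ψ (subst x i (x i - s)) = 0 := by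
      intro s hs
      by_contra hne
      have h1 := hR x i (x i - s) (right_ne_zero_of_mul hne)
      have h2 : |x i| ≤ max |a i| |b i| := abs_le_max_abs_abs (hx i).1.le (hx i).2.le
      apply hs
      have h3 : |s| ≤ |x i - s| + |x i| := by
        have := abs_sub (x i) (x i - s)
        rw [sub_sub_cancel] at this
        linarith
      exact abs_le.1 (by linarith)
    rw [← setIntegral_eq_integral_of_forall_compl_eq_zero (s := Set.Icc (-R') R')
      (fun s hs => hz s hs)]
    refine norm_integral_le_of_norm_le (hint.norm.mul_const M) (Filter.Eventually.of_forall ?_)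
    intro s
    rw [norm_mul]
    exact mul_le_mul_of_nonneg_left (hM _) (norm_nonneg _)

end conv

/-! ### Riemann–Liouville derivatives of test functions -/

theorem slice_eq_zero {a b : Fin 3 → ℝ} {φ : E3 → ℝ} (h : tsupport φ ⊆ box a b)
    (x : E3) (i : Fin 3) {t : ℝ} (ht : t ∉ Set.Ioo (a i) (b i)) : φ (subst x i t) = 0 := by
  by_contra hne
  apply ht
  have := h (subset_tsupport _ hne) i
  rwa [subst_apply_same] at this

theorem leftRL_eq {a b : Fin 3 → ℝ} {α : ℝ} {φ : E3 → ℝ} (h : tsupport φ ⊆ box a b)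
    (i : Fin 3) {x : E3} (hx : x ∈ box a b) :
    leftRL a α φ i x = 1 / Real.Gamma (⌊α⌋₊ + 1 - α) *
      convDeriv (kern (α - ⌊α⌋₊)) (⌊α⌋₊ + 1) i φ x := by
  unfold leftRL convDeriv
  congr 1
  refine Filter.EventuallyEq.iteratedDeriv_eq _ ?_
  filter_upwards [Ioi_mem_nhds (hx i).1] with s hs
  rw [intervalIntegral.integral_of_le (le_of_lt hs), integral_Ioc_eq_integral_Ioo,
    convolution_eq_swap, ← integral_indicator measurableSet_Ioo]
  congr 1
  funext t
  simp only [ContinuousLinearMap.lsmul_apply, smul_eq_mul]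
  by_cases h1 : t ∈ Set.Ioo (a i) s
  · rw [Set.indicator_of_mem h1, kern, Set.indicator_of_mem (by simpa using h1.2)]
    ring
  · rw [Set.indicator_of_notMem h1]
    by_cases h2 : t < s
    · rw [slice_eq_zero h x i (fun h3 => h1 ⟨h3.1, h2⟩), mul_zero]
    · rw [kern, Set.indicator_of_notMem (by simpa using h2), zero_mul]

theorem rightRL_eq {a b : Fin 3 → ℝ} {α : ℝ} {φ : E3 → ℝ} (h : tsupport φ ⊆ box a b)
    (i : Fin 3) {x : E3} (hx : x ∈ box a b) :
    rightRL b α φ i x = 1 / Real.Gamma (⌊α⌋₊ + 1 - α) * ((-1) ^ (⌊α⌋₊ + 1) *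
      convDeriv (fun s => kern (α - ⌊α⌋₊) (-s)) (⌊α⌋₊ + 1) i φ x) := by
  unfold rightRL convDeriv
  congr 2
  refine Filter.EventuallyEq.iteratedDeriv_eq _ ?_
  filter_upwards [Iio_mem_nhds (hx i).2] with s hs
  rw [intervalIntegral.integral_of_le (le_of_lt hs), integral_Ioc_eq_integral_Ioo,
    convolution_eq_swap, ← integral_indicator measurableSet_Ioo]
  congr 1
  funext t
  simp only [ContinuousLinearMap.lsmul_apply, smul_eq_mul, neg_sub]
  by_cases h1 : t ∈ Set.Ioo s (b i)
  · rw [Set.indicator_of_mem h1, kern, Set.indicator_of_mem (by simpa using h1.1)]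
    ring
  · rw [Set.indicator_of_notMem h1]
    by_cases h2 : s < t
    · rw [slice_eq_zero h x i (fun h3 => h1 ⟨h2, h3.2⟩), mul_zero]
    · rw [kern, Set.indicator_of_notMem (by simpa using h2), zero_mul]

/-- Lebesgue measure on the box. -/
abbrev boxMeasure (a b : Fin 3 → ℝ) : Measure E3 := volume.restrict (box a b : Set E3)

section grad

variable {a b : Fin 3 → ℝ} (α : ℝ) (φ ψ : 𝓓(box a b, ℝ))

theorem ae_mem_box : ∀ᵐ x ∂(boxMeasure a b), x ∈ box a b :=
  ae_restrict_mem (box a b).isOpen.measurableSet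

theorem memLp_vec {f : Fin 3 → E3 → ℝ} {μ : Measure E3} (h : ∀ i, MemLp (f i) 2 μ) :
    MemLp (fun x => (WithLp.toLp 2 fun i => f i x : E3)) 2 μ := by
  have : (fun x => (WithLp.toLp 2 fun i => f i x : E3)) =
      ∑ i, fun x => (f i x) • (EuclideanSpace.single i (1 : ℝ) : E3) := by
    funext x
    ext j
    simp [Finset.sum_apply, Pi.single_apply]
  rw [this]
  refine memLp_finsetSum' _ fun i _ => ?_
  exact ((ContinuousLinearMap.id ℝ ℝ).smulRight
    (EuclideanSpace.single i (1 : ℝ) : E3)).comp_memLp' (h i)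

theorem memLp_leftGrad : MemLp (leftGrad a α φ) 2 (boxMeasure a b) := by
  refine memLp_vec fun i => ?_
  refine (MemLp.const_mul (memLp_convDeriv (n := ⌊α⌋₊ + 1) (i := i)
    (locallyIntegrable_kern (floor_frac_lt_one α)) (measurable_kern _) φ.contDiff
    φ.hasCompactSupport a b) (1 / Real.Gamma (⌊α⌋₊ + 1 - α))).ae_eq ?_
  filter_upwards [ae_mem_box] with x hx
  exact (leftRL_eq φ.tsupport_subset i hx).symm

theorem memLp_rightGrad : MemLp (rightGrad b α φ) 2 (boxMeasure a b) := by
  refine memLp_vec fun i => ?_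
  refine (MemLp.const_mul (MemLp.const_mul (memLp_convDeriv (n := ⌊α⌋₊ + 1) (i := i)
    (locallyIntegrable_kern_neg (floor_frac_lt_one α))
    ((measurable_kern _).comp measurable_neg) φ.contDiff
    φ.hasCompactSupport a b) ((-1) ^ (⌊α⌋₊ + 1))) (1 / Real.Gamma (⌊α⌋₊ + 1 - α))).ae_eq ?_
  filter_upwards [ae_mem_box] with x hx
  exact (rightRL_eq φ.tsupport_subset i hx).symm

theorem leftGrad_add :
    leftGrad a α (φ + ψ : 𝓓(box a b, ℝ)) =ᵐ[boxMeasure a b] leftGrad a α φ + leftGrad a α ψ := by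
  filter_upwards [ae_mem_box] with x hx
  ext i
  change leftRL a α (φ + ψ : 𝓓(box a b, ℝ)) i x = leftRL a α φ i x + leftRL a α ψ i x
  rw [leftRL_eq (φ + ψ).tsupport_subset i hx, leftRL_eq φ.tsupport_subset i hx,
    leftRL_eq ψ.tsupport_subset i hx, ← mul_add]
  congr 1
  exact convDeriv_add (locallyIntegrable_kern (floor_frac_lt_one α)) φ.contDiff
    φ.hasCompactSupport ψ.contDiff ψ.hasCompactSupport x

theorem rightGrad_add :
    rightGrad b α (φ + ψ : 𝓓(box a b, ℝ)) =ᵐ[boxMeasure a b]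
      rightGrad b α φ + rightGrad b α ψ := by
  filter_upwards [ae_mem_box] with x hx
  ext i
  change rightRL b α (φ + ψ : 𝓓(box a b, ℝ)) i x = rightRL b α φ i x + rightRL b α ψ i x
  rw [rightRL_eq (φ + ψ).tsupport_subset i hx, rightRL_eq φ.tsupport_subset i hx,
    rightRL_eq ψ.tsupport_subset i hx, ← mul_add, ← mul_add]
  congr 2
  exact convDeriv_add (locallyIntegrable_kern_neg (floor_frac_lt_one α)) φ.contDiff
    φ.hasCompactSupport ψ.contDiff ψ.hasCompactSupport x

theorem leftGrad_smul (c : ℝ) :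
    leftGrad a α (c • φ : 𝓓(box a b, ℝ)) =ᵐ[boxMeasure a b] c • leftGrad a α φ := by
  filter_upwards [ae_mem_box] with x hx
  ext i
  change leftRL a α (c • φ : 𝓓(box a b, ℝ)) i x = c * leftRL a α φ i x
  rw [leftRL_eq (c • φ).tsupport_subset i hx, leftRL_eq φ.tsupport_subset i hx, mul_left_comm]
  congr 1
  exact convDeriv_smul (locallyIntegrable_kern (floor_frac_lt_one α)) φ.contDiff
    φ.hasCompactSupport c x

theorem rightGrad_smul (c : ℝ) :
    rightGrad b α (c • φ : 𝓓(box a b, ℝ)) =ᵐ[boxMeasure a b] c • rightGrad b α φ := by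
  filter_upwards [ae_mem_box] with x hx
  ext i
  change rightRL b α (c • φ : 𝓓(box a b, ℝ)) i x = c * rightRL b α φ i x
  rw [rightRL_eq (c • φ).tsupport_subset i hx, rightRL_eq φ.tsupport_subset i hx,
    mul_left_comm c, mul_left_comm c]
  congr 2
  exact convDeriv_smul (locallyIntegrable_kern_neg (floor_frac_lt_one α)) φ.contDiff
    φ.hasCompactSupport c x

end grad

/-! ### The Fourier side -/

theorem fourier_eq (u : E3 → ℝ) (ξ : E3) :
    fourier u ξ = ((2 * Real.pi) ^ (-(3 / 2 : ℝ)) : ℝ) •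
      FourierTransform.fourier (fun x => (u x : ℂ)) ((2 * Real.pi)⁻¹ • ξ) := by
  rw [fourier, Real.fourier_eq', Complex.real_smul]
  congr 2
  funext x
  rw [smul_eq_mul, mul_comm, inner_smul_right]
  congr 2
  push_cast
  have : (Real.pi : ℂ) ≠ 0 := by exact_mod_cast Real.pi_ne_zero
  field_simp

/-- The test function as a complex Schwartz function. -/
def toSchwartz {Ω : TopologicalSpace.Opens E3} (φ : 𝓓(Ω, ℝ)) : SchwartzMap E3 ℂ :=
  HasCompactSupport.toSchwartzMap (f := fun x => (φ x : ℂ))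
    (φ.hasCompactSupport.comp_left (g := ((↑) : ℝ → ℂ)) Complex.ofReal_zero)
    (Complex.ofRealCLM.contDiff.comp φ.contDiff)

theorem memLp_pow_mul_schwartz {α : ℝ} (hα : 0 ≤ α) (f : SchwartzMap E3 ℂ) :
    MemLp (fun ξ => ‖ξ‖ ^ α • f ξ) 2 := by
  obtain ⟨n, hn⟩ := exists_nat_ge α
  obtain ⟨C, hC⟩ := f.decay n 0
  have hf := f.memLp 2
  have hm : AEStronglyMeasurable (fun ξ : E3 => ‖ξ‖ ^ α • f ξ) volume :=
    (Continuous.smul (continuous_norm.rpow_const fun _ => Or.inr hα)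
      f.continuous).aestronglyMeasurable
  rw [memLp_two_iff_integrable_sq_norm hm]
  have h1 := (memLp_two_iff_integrable_sq_norm hf.1).1 hf
  have h2 := (f.integrable_pow_mul volume n).const_mul C
  refine (h1.add h2).mono' (hm.norm.pow 2) (Filter.Eventually.of_forall fun ξ => ?_)
  have hd : ‖ξ‖ ^ n * ‖f ξ‖ ≤ C := by simpa using hC.2 ξ
  simp only [Pi.add_apply]
  rw [Real.norm_of_nonneg (by positivity), norm_smul, Real.norm_of_nonneg (by positivity)]
  have hCn : 0 ≤ C := hC.1.le
  rcases le_total ‖ξ‖ 1 with h | h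
  · have h3 : ‖ξ‖ ^ α * ‖f ξ‖ ≤ ‖f ξ‖ :=
      mul_le_of_le_one_left (norm_nonneg _) (Real.rpow_le_one (norm_nonneg _) h hα)
    have h4 : (‖ξ‖ ^ α * ‖f ξ‖) ^ 2 ≤ ‖f ξ‖ ^ 2 := by gcongr
    have : 0 ≤ C * (‖ξ‖ ^ n * ‖f ξ‖) := by positivity
    linarith
  · have h3 : ‖ξ‖ ^ α * ‖f ξ‖ ≤ ‖ξ‖ ^ n * ‖f ξ‖ := by
      gcongr
      rw [← Real.rpow_natCast]
      exact Real.rpow_le_rpow_of_exponent_le h hn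
    have h4 : (‖ξ‖ ^ α * ‖f ξ‖) ^ 2 ≤ C * (‖ξ‖ ^ n * ‖f ξ‖) := by
      rw [sq]
      exact mul_le_mul (h3.trans hd) h3 (by positivity) hCn
    have : 0 ≤ ‖f ξ‖ ^ 2 := by positivity
    linarith

section fourier

variable {Ω : TopologicalSpace.Opens E3} (φ ψ : 𝓓(Ω, ℝ))

theorem fourier_eq_schwartz (ξ : E3) :
    fourier φ ξ = ((2 * Real.pi) ^ (-(3 / 2 : ℝ)) : ℝ) •
      FourierTransform.fourier (toSchwartz φ) ((2 * Real.pi)⁻¹ • ξ) := by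
  rw [fourier_eq, SchwartzMap.fourier_coe]
  rfl

theorem memLp_fourier {α : ℝ} (hα : 0 ≤ α) :
    MemLp (fun ξ => ‖ξ‖ ^ α • fourier φ ξ) 2 := by
  have h := memLp_pow_mul_schwartz hα (SchwartzMap.compCLMOfContinuousLinearEquiv ℂ
    (ContinuousLinearEquiv.smulLeft (Units.mk0 (2 * Real.pi)⁻¹ (by positivity)) : E3 ≃L[ℝ] E3)
    (FourierTransform.fourier (toSchwartz φ)))
  refine (h.const_smul ((2 * Real.pi) ^ (-(3 / 2 : ℝ)) : ℝ)).ae_eq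
    (Filter.Eventually.of_forall fun ξ => ?_)
  simp only [Pi.smul_apply]
  rw [fourier_eq_schwartz, smul_comm]
  rfl

theorem fourier_add (ξ : E3) :
    fourier (φ + ψ : 𝓓(Ω, ℝ)) ξ = fourier φ ξ + fourier ψ ξ := by
  have : toSchwartz (φ + ψ) = toSchwartz φ + toSchwartz ψ := by
    ext x
    exact Complex.ofReal_add _ _
  simp only [fourier_eq_schwartz, this, FourierTransform.fourier_add, add_apply,
    smul_add]

theorem fourier_smul (c : ℝ) (ξ : E3) :
    fourier (c • φ : 𝓓(Ω, ℝ)) ξ = c • fourier φ ξ := by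
  have : toSchwartz (c • φ) = c • toSchwartz φ := by
    ext x
    simp only [smul_apply, Complex.real_smul]
    exact Complex.ofReal_mul _ _
  simp only [fourier_eq_schwartz, this, FourierTransform.fourier_smul, smul_apply]
  rw [smul_comm]

end fourier

/-! ### The fractional seminorms on test functions -/

/-- The seminorm `|φ|_{F_L^α(Ω)} = (∫_Ω ‖∇^α φ‖²)^{1/2}` on `C₀^∞(Ω)`. -/
def leftSeminorm (a b : Fin 3 → ℝ) (α : ℝ) : Seminorm ℝ 𝓓(box a b, ℝ) :=
  Seminorm.of (fun φ => l2norm (boxMeasure a b) (leftGrad a α φ))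
    (fun φ ψ => by
      rw [l2norm_congr (leftGrad_add α φ ψ)]
      exact l2norm_add_le (memLp_leftGrad α φ) (memLp_leftGrad α ψ))
    (fun c φ => by rw [l2norm_congr (leftGrad_smul α φ c), l2norm_smul])

/-- The seminorm `|φ|_{F_R^α(Ω)} = (∫_Ω ‖∇^{α*} φ‖²)^{1/2}` on `C₀^∞(Ω)`. -/
def rightSeminorm (a b : Fin 3 → ℝ) (α : ℝ) : Seminorm ℝ 𝓓(box a b, ℝ) :=
  Seminorm.of (fun φ => l2norm (boxMeasure a b) (rightGrad b α φ))
    (fun φ ψ => by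
      rw [l2norm_congr (rightGrad_add α φ ψ)]
      exact l2norm_add_le (memLp_rightGrad α φ) (memLp_rightGrad α ψ))
    (fun c φ => by rw [l2norm_congr (rightGrad_smul α φ c), l2norm_smul])

theorem sqrt_fourier_eq (u : E3 → ℝ) (α : ℝ) :
    Real.sqrt (∫ ξ : E3, ‖ξ‖ ^ (2 * α) * ‖fourier u ξ‖ ^ 2) =
      l2norm volume (fun ξ : E3 => ‖ξ‖ ^ α • fourier u ξ) := by
  unfold l2norm
  congr 2
  funext ξ
  rw [norm_smul, mul_pow, Real.norm_of_nonneg (by positivity), ← Real.rpow_mul_natCast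
    (norm_nonneg _), mul_comm α]
  norm_num

/-- The seminorm `|φ|_{H^α} = (∫ ‖ξ‖^{2α} |φ̂(ξ)|² dξ)^{1/2}` on `C₀^∞(Ω)`; test functions are
extended by zero outside `Ω`. -/
def sobolevSeminorm (a b : Fin 3 → ℝ) (α : ℝ) (hα : 0 < α) : Seminorm ℝ 𝓓(box a b, ℝ) :=
  Seminorm.of (fun φ => Real.sqrt (∫ ξ : E3, ‖ξ‖ ^ (2 * α) * ‖fourier φ ξ‖ ^ 2))
    (fun φ ψ => by
      simp only [sqrt_fourier_eq]
      refine le_trans (le_of_eq ?_) (l2norm_add_le (memLp_fourier φ hα.le)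
        (memLp_fourier ψ hα.le))
      congr 1
      funext ξ
      simp only [fourier_add, smul_add, Pi.add_apply])
    (fun c φ => by
      simp only [sqrt_fourier_eq]
      rw [← l2norm_smul]
      congr 1
      funext ξ
      simp only [fourier_smul, Pi.smul_apply]
      rw [smul_comm])

/-! ### Closure of the test functions under a fractional norm -/

section closure

variable {a b : Fin 3 → ℝ}

theorem memLp_test (φ : 𝓓(box a b, ℝ)) : MemLp φ 2 (boxMeasure a b) :=
  (φ.continuous.memLp_of_hasCompactSupport φ.hasCompactSupport).restrict _

/-- The class in `L²(Ω)` of a test function. -/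
def testToL2 : 𝓓(box a b, ℝ) →ₗ[ℝ] Lp ℝ 2 (boxMeasure a b) where
  toFun φ := (memLp_test φ).toLp φ
  map_add' _ _ := rfl
  map_smul' _ _ := rfl

theorem norm_testToL2 (φ : 𝓓(box a b, ℝ)) : ‖testToL2 φ‖ = l2norm (boxMeasure a b) φ := by
  rw [l2norm_eq_toReal (memLp_test φ)]
  exact Lp.norm_toLp _ (memLp_test φ)

/-- The norm `(‖φ‖²_{L²(Ω)} + |φ|²)^{1/2}` on `C₀^∞(Ω)` attached to a seminorm `|·|`. -/
def fullNorm (S : Seminorm ℝ 𝓓(box a b, ℝ)) : Seminorm ℝ 𝓓(box a b, ℝ) :=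
  Seminorm.of (fun φ => Real.sqrt (l2norm (boxMeasure a b) φ ^ 2 + S φ ^ 2))
    (fun φ ψ => by
      simp only [← norm_testToL2, map_add]
      have h1 := norm_add_le (testToL2 φ) (testToL2 ψ)
      have h2 := map_add_le_add S φ ψ
      have h3 := norm_add_le (WithLp.toLp 2 (‖testToL2 φ‖, S φ) : WithLp 2 (ℝ × ℝ))
        (WithLp.toLp 2 (‖testToL2 ψ‖, S ψ))
      simp only [WithLp.prod_norm_eq_of_L2, WithLp.add_fst, WithLp.add_snd, Real.norm_eq_abs,
        sq_abs] at h3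
      refine le_trans (Real.sqrt_le_sqrt ?_) h3
      have := apply_nonneg S (φ + ψ)
      exact add_le_add (pow_le_pow_left₀ (norm_nonneg _) h1 2) (pow_le_pow_left₀ this h2 2))
    (fun c φ => by
      simp only [← norm_testToL2, map_smul, norm_smul, map_smul_eq_mul, mul_pow]
      rw [← mul_add, Real.sqrt_mul (by positivity), Real.sqrt_sq (norm_nonneg c)])

/-- The space `C₀^∞(Ω)` equipped with the norm `fullNorm S`. -/
def NormedTest (_S : Seminorm ℝ 𝓓(box a b, ℝ)) : Type := 𝓓(box a b, ℝ)

instance (S : Seminorm ℝ 𝓓(box a b, ℝ)) : AddCommGroup (NormedTest S) :=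
  inferInstanceAs (AddCommGroup 𝓓(box a b, ℝ))

instance (S : Seminorm ℝ 𝓓(box a b, ℝ)) : Module ℝ (NormedTest S) :=
  inferInstanceAs (Module ℝ 𝓓(box a b, ℝ))

/-- The identity map of `C₀^∞(Ω)`, forgetting the norm. -/
def NormedTest.equiv (S : Seminorm ℝ 𝓓(box a b, ℝ)) : NormedTest S ≃ₗ[ℝ] 𝓓(box a b, ℝ) :=
  LinearEquiv.refl ℝ 𝓓(box a b, ℝ)

instance (S : Seminorm ℝ 𝓓(box a b, ℝ)) : SeminormedAddCommGroup (NormedTest S) :=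
  ((fullNorm S).comp (NormedTest.equiv S).toLinearMap).toSeminormedAddCommGroup

theorem NormedTest.norm_eq (S : Seminorm ℝ 𝓓(box a b, ℝ)) (φ : NormedTest S) :
    ‖φ‖ = fullNorm S (NormedTest.equiv S φ) := rfl

instance (S : Seminorm ℝ 𝓓(box a b, ℝ)) : NormedSpace ℝ (NormedTest S) where
  norm_smul_le c φ := by
    rw [NormedTest.norm_eq, NormedTest.norm_eq, map_smul, map_smul_eq_mul]

/-- The closure of `C₀^∞(Ω)` under the norm `fullNorm S`. -/
abbrev TestClosure (S : Seminorm ℝ 𝓓(box a b, ℝ)) : Type :=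
  UniformSpace.Completion (NormedTest S)

/-- A test function as an element of the closure. -/
def ofTest (S : Seminorm ℝ 𝓓(box a b, ℝ)) (φ : 𝓓(box a b, ℝ)) : TestClosure S :=
  (((NormedTest.equiv S).symm φ : NormedTest S) : UniformSpace.Completion (NormedTest S))

theorem fullNorm_apply (S : Seminorm ℝ 𝓓(box a b, ℝ)) (φ : 𝓓(box a b, ℝ)) :
    fullNorm S φ = Real.sqrt (l2norm (boxMeasure a b) φ ^ 2 + S φ ^ 2) := rfl

/-- The class in `L²(Ω)` of a test function, as a bounded operator for the norm `fullNorm S`. -/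
def normedTestToL2 (S : Seminorm ℝ 𝓓(box a b, ℝ)) :
    NormedTest S →L[ℝ] Lp ℝ 2 (boxMeasure a b) :=
  LinearMap.mkContinuous (testToL2 ∘ₗ (NormedTest.equiv S).toLinearMap) 1 fun φ => by
    rw [one_mul, NormedTest.norm_eq, fullNorm_apply, LinearMap.comp_apply,
      LinearEquiv.coe_coe, norm_testToL2]
    exact Real.le_sqrt_of_sq_le (le_add_of_nonneg_right (sq_nonneg _))

/-- The canonical map of the closure to `L²(Ω)`: a limit of test functions is sent to its limit
in `L²(Ω)`. -/
def toL2 (S : Seminorm ℝ 𝓓(box a b, ℝ)) : TestClosure S →L[ℝ] Lp ℝ 2 (boxMeasure a b) :=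
  (normedTestToL2 S).extend (UniformSpace.Completion.toComplL (𝕜 := ℝ) (E := NormedTest S))

theorem toL2_ofTest (S : Seminorm ℝ 𝓓(box a b, ℝ)) (φ : 𝓓(box a b, ℝ)) :
    toL2 S (ofTest S φ) = testToL2 φ :=
  (normedTestToL2 S).extend_eq
    (e := UniformSpace.Completion.toComplL (𝕜 := ℝ) (E := NormedTest S))
    UniformSpace.Completion.denseRange_coe
    (UniformSpace.Completion.isUniformInducing_coe _) ((NormedTest.equiv S).symm φ)

theorem norm_ofTest (S : Seminorm ℝ 𝓓(box a b, ℝ)) (φ : 𝓓(box a b, ℝ)) :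
    ‖ofTest S φ‖ = Real.sqrt (l2norm (boxMeasure a b) φ ^ 2 + S φ ^ 2) := by
  rw [ofTest, UniformSpace.Completion.norm_coe]
  rfl

/-- Two closures of `C₀^∞(Ω)` are equivalent as normed spaces of functions on `Ω`: both are spaces
of `L²(Ω)` functions, they have the same elements, and their norms are equivalent. -/
def EquivalentSpaces (S T : Seminorm ℝ 𝓓(box a b, ℝ)) : Prop :=
  Function.Injective (toL2 S) ∧ Function.Injective (toL2 T) ∧
  Set.range (toL2 S) = Set.range (toL2 T) ∧
  ∃ c C : ℝ, 0 < c ∧ 0 < C ∧ ∀ (u : TestClosure S) (v : TestClosure T),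
    toL2 S u = toL2 T v → c * ‖v‖ ≤ ‖u‖ ∧ ‖u‖ ≤ C * ‖v‖

end closure

end FracSobolev

end

/-! Write n = ⌊α⌋ + 1, β = α − ⌊α⌋ and γ = 1 − β, so that α = n − γ. On the box, the left derivative
of a test function φ is, up to the factor 1/Γ(γ), the convolution along the i-th axis of the
one-sided kernel s₊^{-β} with ∂ᵢⁿφ; the right derivative uses the reflected kernel and a sign.
Formally their Fourier symbols are (iw)^{n-γ} and its conjugate, with w the i-th frequency, and both
have modulus |w|^α. So over all of ℝ³ each one-sided energy would equal the directional Sobolev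
energy, and restricting to the box gives the upper bound.

The lower bound on the box is the real issue. The left convolution at x sees φ only at points behind
x in the i-th direction, the right one only at points ahead of x. Hence their product vanishes
outside the box (`left_mul_right_eq_zero`), and its integral over the box is its integral over ℝ³,
which Parseval evaluates as cos(πγ) times the Sobolev energy, with common factors Γ(γ)².
Cauchy–Schwarz on the box then bounds each one-sided energy from below by cos²(πγ) times the Sobolev
energy (`box_energy_bounds`). The factor cos(πγ) vanishes exactly when β = 1/2, which is the
excluded case.

The kernel is not integrable at infinity, so everything is done with s₊^{-β}e^{-εs}, whose symbol is
Γ(γ)(ε + iw)^{-γ}(iw)^n, and ε → 0 at the end: on the frequency side in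
`tendsto_integral_left_mul_right`, on the box in `tendsto_integral_lineConv_sq`.

Comparability of norms on test functions passes to completions (`equivalentSpaces_of_le`) once one
canonical map is known to be injective. For the Sobolev closure this holds because multiplication by
‖ξ‖^α is a closed operator on L² (`injective_toL2_sobolev`). -/

noncomputable section

namespace FracSobolev

/-! ### Convolution along a line, its Fourier transform, and Parseval's formula -/

section generic

open FourierTransform

variable {V : Type*} [NormedAddCommGroup V] [InnerProductSpace ℝ V]

/-- Convolution of a function on `V` with a kernel on the line spanned by `v`. -/
def lineConv (K : ℝ → ℝ) (v : V) (f : V → ℝ) (x : V) : ℝ := ∫ s, K s * f (x - s • v)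

variable {K : ℝ → ℝ} {v : V} {f : V → ℝ}

theorem continuous_lineConv (hK : Integrable K) (hf : Continuous f) {M : ℝ}
    (hM : ∀ x, ‖f x‖ ≤ M) : Continuous (lineConv K v f) := by
  refine continuous_of_dominated (bound := fun s => ‖K s‖ * M) (fun x => ?_) (fun x => ?_)
    (hK.norm.mul_const M) ?_
  · exact hK.1.mul (Continuous.aestronglyMeasurable (by fun_prop))
  · refine Filter.Eventually.of_forall fun s => ?_
    rw [norm_mul]
    exact mul_le_mul_of_nonneg_left (hM _) (norm_nonneg _)
  · exact Filter.Eventually.of_forall fun s => by fun_prop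

variable [FiniteDimensional ℝ V] [MeasurableSpace V] [BorelSpace V]

/-- Parseval's formula for integrable functions. -/
theorem integral_inner_fourier_eq {f g : V → ℂ} (hf : Integrable f) (hg : Integrable g)
    (cg : Continuous g) (hg' : Integrable (𝓕 g)) :
    ∫ ξ, inner ℂ (𝓕 f ξ) (𝓕 g ξ) = ∫ x, inner ℂ (f x) (g x) := by
  have h := VectorFourier.integral_sesq_fourierIntegral_eq_neg_flip (innerSL ℂ (E := ℂ))
    (L := innerₗ V) Real.continuous_fourierChar continuous_inner hf hg'
  -- The transform with the opposite sign is the inverse one, so inversion returns `g`; this is why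
  -- integrability of the transform is asked of `g` alone.
  have h2 : ∀ x, VectorFourier.fourierIntegral Real.fourierChar volume (-(innerₗ V).flip) (𝓕 g) x
      = g x := by
    intro x
    rw [← congrFun (cg.fourierInv_fourier_eq hg hg') x, flip_innerₗ]
    rfl
  simp only [h2] at h
  exact h

theorem integrable_lineConv_integrand (hK : Integrable K) (hf : Continuous f)
    (hf' : Integrable f) :
    Integrable (fun p : V × ℝ => K p.2 * f (p.1 - p.2 • v)) (volume.prod volume) := by
  have hm : AEStronglyMeasurable (fun p : V × ℝ => K p.2 * f (p.1 - p.2 • v))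
      (volume.prod volume) :=
    hK.1.comp_snd.mul (Continuous.aestronglyMeasurable (by fun_prop))
  rw [integrable_prod_iff' hm]
  refine ⟨Filter.Eventually.of_forall fun s =>
    (hf'.comp_sub_right (s • v)).const_mul (K s), ?_⟩
  simp only [norm_mul, integral_const_mul]
  have : ∀ s : ℝ, ∫ x : V, ‖f (x - s • v)‖ = ∫ x, ‖f x‖ := fun s =>
    integral_sub_right_eq_self (fun x => ‖f x‖) (s • v)
  simp only [this]
  exact hK.norm.mul_const _

theorem integrable_lineConv (hK : Integrable K) (hf : Continuous f) (hf' : Integrable f) :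
    Integrable (lineConv K v f) :=
  (integrable_lineConv_integrand hK hf hf').integral_prod_left

/-- Fubini, then translation of the inner integral by `s • v`: the convolution becomes
multiplication by the one-dimensional transform of `K` at frequency `2π⟨v, ξ⟩`. -/
theorem fourier_lineConv (hK : Integrable K) (hf : Continuous f) (hf' : Integrable f) (ξ : V) :
    𝓕 (fun x => (lineConv K v f x : ℂ)) ξ =
      (∫ s : ℝ, (K s : ℂ) * Complex.exp (-((2 * Real.pi * inner ℝ v ξ : ℝ) * Complex.I) * s)) *
        𝓕 (fun x => (f x : ℂ)) ξ := by
  have hint := (integrable_lineConv_integrand (v := v) hK hf hf').ofReal (𝕜 := ℂ)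
  calc 𝓕 (fun x => (lineConv K v f x : ℂ)) ξ
      = ∫ x, ∫ s : ℝ, Complex.exp (↑(-2 * Real.pi * inner ℝ x ξ) * Complex.I) *
          ((K s * f (x - s • v) : ℝ) : ℂ) := by
        rw [Real.fourier_eq']
        congr 1
        funext x
        rw [lineConv, ← integral_complex_ofReal, smul_eq_mul, integral_const_mul]
    _ = ∫ s : ℝ, ∫ x, Complex.exp (↑(-2 * Real.pi * inner ℝ x ξ) * Complex.I) *
          ((K s * f (x - s • v) : ℝ) : ℂ) := by
        refine integral_integral_swap ?_
        refine hint.bdd_mul (c := 1) (Continuous.aestronglyMeasurable (by fun_prop)) ?_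
        refine Filter.Eventually.of_forall fun p => ?_
        rw [Complex.norm_exp_ofReal_mul_I]
    _ = ∫ s : ℝ, ((K s : ℂ) * Complex.exp (-((2 * Real.pi * inner ℝ v ξ : ℝ) * Complex.I) * s)) *
          𝓕 (fun x => (f x : ℂ)) ξ := by
        congr 1
        funext s
        rw [Real.fourier_eq', ← integral_sub_right_eq_self (fun x : V =>
          Complex.exp (↑(-2 * Real.pi * inner ℝ x ξ) * Complex.I) • (f x : ℂ)) (s • v),
          ← integral_const_mul]
        congr 1
        funext x
        have : Complex.exp (↑(-2 * Real.pi * inner ℝ x ξ) * Complex.I) =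
            Complex.exp (-((2 * Real.pi * inner ℝ v ξ : ℝ) * Complex.I) * s) *
            Complex.exp (↑(-2 * Real.pi * inner ℝ (x - s • v) ξ) * Complex.I) := by
          rw [← Complex.exp_add, inner_sub_left, real_inner_smul_left]
          congr 1
          push_cast
          ring
        rw [this, smul_eq_mul]
        push_cast
        ring
    _ = _ := integral_mul_const _ _

end generic

/-! ### The Laplace transform of a power on the right half-plane -/

section laplace

/-- The Laplace transform of a power, for a complex argument. -/
theorem integral_rpow_mul_cexp_neg_mul_Ioi {γ : ℝ} (hγ : 0 < γ) {z : ℂ} (hz : 0 < z.re) :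
    ∫ t in Set.Ioi (0 : ℝ), ((t ^ (γ - 1) : ℝ) : ℂ) * Complex.exp (-z * t) =
      (1 / z) ^ (γ : ℂ) * Real.Gamma γ := by
  -- Analytic continuation from the positive reals. The integral is the complex moment generating
  -- function of `-t` under the density `t^(γ-1)`, which is already known to be analytic.
  set μ : Measure ℝ := (volume.restrict (Set.Ioi 0)).withDensity
    fun t => ENNReal.ofReal (t ^ (γ - 1)) with hμ
  have hmeas : Measurable fun t : ℝ => t ^ (γ - 1) := by fun_prop
  have key : ∀ w : ℂ, ProbabilityTheory.complexMGF (fun t : ℝ => -t) μ w =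
      ∫ t in Set.Ioi (0 : ℝ), ((t ^ (γ - 1) : ℝ) : ℂ) * Complex.exp (-w * t) := by
    intro w
    rw [ProbabilityTheory.complexMGF, hμ, integral_withDensity_eq_integral_toReal_smul (by fun_prop)
      (Filter.Eventually.of_forall fun _ => ENNReal.ofReal_lt_top)]
    refine setIntegral_congr_fun measurableSet_Ioi fun t ht => ?_
    have : 0 ≤ t ^ (γ - 1) := Real.rpow_nonneg (le_of_lt ht) _
    simp only [ENNReal.toReal_ofReal this, Complex.real_smul]
    congr 2
    push_cast
    ring
  have hset : Set.Ioi (0 : ℝ) ⊆ interior (ProbabilityTheory.integrableExpSet (fun t : ℝ => -t) μ) := by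
    refine interior_maximal ?_ isOpen_Ioi
    intro r hr
    change Integrable _ μ
    rw [hμ, integrable_withDensity_iff_integrable_smul' (by fun_prop)
      (Filter.Eventually.of_forall fun _ => ENNReal.ofReal_lt_top)]
    have h := Real.GammaIntegral_convergent hγ
    have h2 := (integrableOn_Ioi_comp_mul_left_iff (fun x => Real.exp (-x) * x ^ (γ - 1)) 0
      (show (0 : ℝ) < r from hr)).2 (by simpa using h)
    refine IntegrableOn.congr_fun (Integrable.const_mul h2 (r ^ (γ - 1))⁻¹) ?_ measurableSet_Ioi
    intro t ht
    have : 0 ≤ t ^ (γ - 1) := Real.rpow_nonneg (le_of_lt ht) _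
    have hr' : (r ^ (γ - 1)) ≠ 0 := (Real.rpow_pos_of_pos hr _).ne'
    simp only [ENNReal.toReal_ofReal this, smul_eq_mul]
    rw [Real.mul_rpow (le_of_lt hr) (le_of_lt ht)]
    field_simp
  have hopen : IsOpen {w : ℂ | 0 < w.re} := isOpen_lt continuous_const Complex.continuous_re
  have hslit : ∀ w : ℂ, 0 < w.re → 1 / w ∈ Complex.slitPlane := by
    intro w hw
    left
    rw [one_div, Complex.inv_re]
    exact div_pos hw (Complex.normSq_pos.2 (by rintro rfl; simp at hw))
  have A : AnalyticOnNhd ℂ (ProbabilityTheory.complexMGF (fun t : ℝ => -t) μ) {w : ℂ | 0 < w.re} :=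
    ProbabilityTheory.analyticOnNhd_complexMGF.mono fun w hw => hset hw
  have B : AnalyticOnNhd ℂ (fun w : ℂ => (1 / w) ^ (γ : ℂ) * Real.Gamma γ) {w : ℂ | 0 < w.re} := by
    refine DifferentiableOn.analyticOnNhd (fun w hw => ?_) hopen
    have hw0 : w ≠ 0 := by rintro rfl; simp at hw
    refine DifferentiableAt.differentiableWithinAt ?_
    refine (DifferentiableAt.cpow ?_ (differentiableAt_const _) (hslit w hw)).mul_const _
    exact (differentiableAt_const _).div differentiableAt_id hw0
  have hpre : IsPreconnected {w : ℂ | 0 < w.re} :=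
    (convex_halfSpace_re_gt 0).isPreconnected
  rw [← key]
  refine A.eqOn_of_preconnected_of_frequently_eq B hpre (z₀ := 1) (by simp) ?_ hz
  have hre : ∀ r : ℝ, 0 < r → ProbabilityTheory.complexMGF (fun t : ℝ => -t) μ r =
      (1 / (r : ℂ)) ^ (γ : ℂ) * Real.Gamma γ := by
    intro r hr
    have h := Complex.integral_cpow_mul_exp_neg_mul_Ioi (a := γ) (by simpa using hγ) hr
    rw [key, ← Complex.Gamma_ofReal, ← h]
    refine setIntegral_congr_fun measurableSet_Ioi fun t ht => ?_
    have ht' : 0 ≤ t := le_of_lt ht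
    rw [Complex.ofReal_cpow ht']
    push_cast
    ring_nf
  -- The identity theorem needs agreement at points accumulating at 1; real numbers near 1 supply
  -- them.
  have ht : Filter.Tendsto (fun r : ℝ => (r : ℂ)) (nhdsWithin 1 {1}ᶜ) (nhdsWithin 1 {1}ᶜ) := by
    refine tendsto_nhdsWithin_iff.2 ⟨?_, ?_⟩
    · have := Complex.continuous_ofReal.tendsto 1
      simp only [Complex.ofReal_one] at this
      exact this.mono_left nhdsWithin_le_nhds
    · filter_upwards [self_mem_nhdsWithin] with r hr
      simpa using hr
  refine ht.frequently (Filter.Eventually.frequently ?_)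
  filter_upwards [nhdsWithin_le_nhds (Ioi_mem_nhds (zero_lt_one (α := ℝ)))] with r hr
  exact hre r hr

end laplace

/-! ### Comparison of completions of the test functions -/

section closure

variable {a b : Fin 3 → ℝ} {S T : Seminorm ℝ 𝓓(box a b, ℝ)}

theorem closure_induction {p : TestClosure S → Prop} (u : TestClosure S)
    (hp : IsClosed {u | p u}) (h : ∀ φ, p (ofTest S φ)) : p u :=
  UniformSpace.Completion.induction_on u hp fun φ => h φ

theorem exists_seq_tendsto_ofTest (u : TestClosure S) :
    ∃ φ : ℕ → 𝓓(box a b, ℝ), Filter.Tendsto (fun k => ofTest S (φ k)) Filter.atTop (nhds u) := by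
  have hd : DenseRange (fun φ : 𝓓(box a b, ℝ) => ofTest S φ) :=
    UniformSpace.Completion.denseRange_coe (α := NormedTest S)
  obtain ⟨x, hx, hu⟩ := mem_closure_iff_seq_limit.1 (hd u)
  choose φ hφ using hx
  exact ⟨φ, by simpa only [hφ] using hu⟩

theorem ofTest_sub (φ ψ : 𝓓(box a b, ℝ)) : ofTest S (φ - ψ) = ofTest S φ - ofTest S ψ := by
  unfold ofTest
  rw [map_sub, UniformSpace.Completion.coe_sub]

/-- An inequality between norms of test functions induces a map of the closures. -/
theorem exists_map_closure {C : ℝ} (h : ∀ φ, fullNorm T φ ≤ C * fullNorm S φ) :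
    ∃ J : TestClosure S →L[ℝ] TestClosure T, ∀ φ, J (ofTest S φ) = ofTest T φ := by
  let j : NormedTest S →L[ℝ] NormedTest T := LinearMap.mkContinuous
    ((NormedTest.equiv T).symm.toLinearMap ∘ₗ (NormedTest.equiv S).toLinearMap) C
    fun φ => h (NormedTest.equiv S φ)
  let j' : NormedTest S →L[ℝ] TestClosure T :=
    (UniformSpace.Completion.toComplL (𝕜 := ℝ) (E := NormedTest T)).comp j
  refine ⟨j'.extend (UniformSpace.Completion.toComplL (𝕜 := ℝ) (E := NormedTest S)), fun φ => ?_⟩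
  exact j'.extend_eq (e := UniformSpace.Completion.toComplL (𝕜 := ℝ) (E := NormedTest S))
    UniformSpace.Completion.denseRange_coe
    (UniformSpace.Completion.isUniformInducing_coe _) ((NormedTest.equiv S).symm φ)

theorem toL2_map_closure {J : TestClosure S →L[ℝ] TestClosure T}
    (hJ : ∀ φ, J (ofTest S φ) = ofTest T φ) (u : TestClosure S) : toL2 T (J u) = toL2 S u := by
  refine closure_induction (p := fun u => toL2 T (J u) = toL2 S u) u (isClosed_eq (by fun_prop) (by fun_prop)) fun φ => ?_
  rw [hJ, toL2_ofTest, toL2_ofTest]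

/-- Equivalent norms on the test functions give equivalent closures. -/
theorem equivalentSpaces_of_le (hT : Function.Injective (toL2 T)) {C C' : ℝ}
    (h : ∀ φ, fullNorm T φ ≤ C * fullNorm S φ) (h' : ∀ φ, fullNorm S φ ≤ C' * fullNorm T φ) :
    EquivalentSpaces S T := by
  obtain ⟨J, hJ⟩ := exists_map_closure h
  obtain ⟨J', hJ'⟩ := exists_map_closure h'
  -- Only this composite is needed: together with injectivity of `toL2 T` it yields injectivity of
  -- `toL2 S`.
  have hinv : ∀ u, J' (J u) = u := fun u => by
    refine closure_induction (p := fun u => J' (J u) = u) u (isClosed_eq (by fun_prop) (by fun_prop)) fun φ => ?_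
    rw [hJ, hJ']
  -- The operator norms are increased by 1 so that the constants are positive even when an operator
  -- vanishes.
  refine ⟨fun u v huv => ?_, hT, ?_, (‖J‖ + 1)⁻¹, ‖J'‖ + 1, by positivity, by positivity, ?_⟩
  · rw [← toL2_map_closure hJ, ← toL2_map_closure hJ] at huv
    rw [← hinv u, hT huv, hinv]
  · ext f
    constructor
    · rintro ⟨u, rfl⟩
      exact ⟨J u, toL2_map_closure hJ u⟩
    · rintro ⟨v, rfl⟩
      exact ⟨J' v, toL2_map_closure hJ' v⟩
  · intro u v huv
    rw [← toL2_map_closure hJ] at huv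
    have hv := hT huv
    constructor
    · rw [inv_mul_le_iff₀ (by positivity), ← hv]
      refine (J.le_opNorm u).trans ?_
      gcongr
      linarith
    · rw [← hinv u, hv]
      refine (J'.le_opNorm v).trans ?_
      gcongr
      linarith

end closure

/-! ### Plancherel and injectivity for the Sobolev closure -/

section sobolev

open FourierTransform

variable {a b : Fin 3 → ℝ}

/-- Passage between the two normalizations of the Fourier transform by ξ ↦ ξ/(2π): the Jacobian
(2π)³ cancels the squared prefactor (2π)⁻³, leaving (2π)^p from the weight. The case p = 0 feeds
Plancherel. -/
theorem integral_rpow_mul_norm_fourier_sq (φ : 𝓓(box a b, ℝ)) (p : ℝ) :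
    ∫ ξ : E3, ‖ξ‖ ^ p * ‖fourier φ ξ‖ ^ 2 =
      (2 * Real.pi) ^ p * ∫ ξ : E3, ‖ξ‖ ^ p * ‖𝓕 (toSchwartz φ) ξ‖ ^ 2 := by
  have hpi : (0 : ℝ) < 2 * Real.pi := by positivity
  have h := Measure.integral_comp_smul (volume : Measure E3)
    (fun ξ : E3 => ‖ξ‖ ^ p * ‖𝓕 (toSchwartz φ) ξ‖ ^ 2) (2 * Real.pi)⁻¹
  have h3 : Module.finrank ℝ E3 = 3 := by simp
  rw [h3, inv_pow, inv_inv, abs_of_pos (by positivity), smul_eq_mul] at h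
  have e : ∀ ξ : E3, ‖ξ‖ ^ p * ‖fourier φ ξ‖ ^ 2 = (2 * Real.pi) ^ p * (((2 * Real.pi) ^ 3)⁻¹ *
      (‖(2 * Real.pi)⁻¹ • ξ‖ ^ p * ‖𝓕 (toSchwartz φ) ((2 * Real.pi)⁻¹ • ξ)‖ ^ 2)) := by
    intro ξ
    rw [fourier_eq_schwartz, norm_smul, norm_smul, Real.norm_of_nonneg (by positivity),
      Real.norm_of_nonneg (by positivity), mul_pow, ← Real.rpow_mul_natCast hpi.le,
      Real.mul_rpow (by positivity) (norm_nonneg _), Real.inv_rpow hpi.le,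
      show (-(3 / 2) : ℝ) * ((2 : ℕ) : ℝ) = -((3 : ℕ) : ℝ) by norm_num, Real.rpow_neg hpi.le,
      Real.rpow_natCast]
    have : (2 * Real.pi) ^ p ≠ 0 := (Real.rpow_pos_of_pos hpi p).ne'
    field_simp
  simp only [e]
  rw [integral_const_mul, integral_const_mul, h]
  congr 1
  rw [← mul_assoc, inv_mul_cancel₀ (by positivity), one_mul]

theorem integral_test_sq (φ : 𝓓(box a b, ℝ)) :
    ∫ x : E3, ‖toSchwartz φ x‖ ^ 2 = ∫ x, ‖φ x‖ ^ 2 ∂(boxMeasure a b) := by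
  rw [setIntegral_eq_integral_of_forall_compl_eq_zero]
  · congr 1
    funext x
    congr 1
    exact Complex.norm_real _
  · intro x hx
    have : φ x = 0 := by
      by_contra hne
      exact hx (φ.tsupport_subset (subset_tsupport _ hne))
    simp [this]

theorem l2norm_fourier (φ : 𝓓(box a b, ℝ)) :
    l2norm volume (fun ξ : E3 => fourier φ ξ) = l2norm (boxMeasure a b) φ := by
  have h := integral_rpow_mul_norm_fourier_sq φ 0
  simp only [Real.rpow_zero, one_mul] at h
  rw [l2norm, l2norm, h, SchwartzMap.integral_norm_sq_fourier, integral_test_sq]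

theorem fourier_sub (φ ψ : 𝓓(box a b, ℝ)) (ξ : E3) :
    fourier (φ - ψ : 𝓓(box a b, ℝ)) ξ = fourier φ ξ - fourier ψ ξ := by
  have h := fourier_add φ ((-1 : ℝ) • ψ) ξ
  rw [fourier_smul] at h
  simpa [sub_eq_add_neg] using h

theorem sobolevSeminorm_apply {α : ℝ} (hα : 0 < α) (φ : 𝓓(box a b, ℝ)) :
    sobolevSeminorm a b α hα φ = l2norm volume (fun ξ : E3 => ‖ξ‖ ^ α • fourier φ ξ) :=
  sqrt_fourier_eq φ α

/-- Closedness of multiplication by ‖ξ‖^α. If test functions converge in the Sobolev norm and tend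
to 0 in L², their transforms tend to 0 in L² while the weighted transforms converge to some `h`;
comparing almost everywhere limits forces `h = 0`, so the full norms tend to 0. -/
theorem injective_toL2_sobolev {α : ℝ} (hα : 0 < α) :
    Function.Injective (toL2 (sobolevSeminorm a b α hα)) := by
  set S := sobolevSeminorm a b α hα with hS
  rw [injective_iff_map_eq_zero]
  intro u hu
  obtain ⟨φ, hφ⟩ := exists_seq_tendsto_ofTest u
  have hF0 : ∀ ψ : 𝓓(box a b, ℝ), MemLp (fun ξ : E3 => fourier ψ ξ) 2 := fun ψ => by
    simpa using memLp_fourier ψ le_rfl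
  let H : ℕ → Lp ℂ 2 (volume : Measure E3) := fun k => (memLp_fourier (φ k) hα.le).toLp _
  let F : ℕ → Lp ℂ 2 (volume : Measure E3) := fun k => (hF0 (φ k)).toLp _
  have hL2 : Filter.Tendsto (fun k => testToL2 (φ k)) Filter.atTop (nhds 0) := by
    have := ((toL2 S).continuous.tendsto u).comp hφ
    rw [hu] at this
    refine this.congr fun k => ?_
    rw [Function.comp_apply, toL2_ofTest]
  have hF : Filter.Tendsto F Filter.atTop (nhds 0) := by
    rw [tendsto_zero_iff_norm_tendsto_zero] at hL2 ⊢
    refine hL2.congr fun k => ?_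
    rw [norm_testToL2, ← l2norm_fourier, l2norm_eq_toReal (hF0 _)]
    exact (Lp.norm_toLp _ _).symm
  have hS_le : ∀ ψ, S ψ ≤ ‖ofTest S ψ‖ := fun ψ => by
    rw [norm_ofTest]
    exact Real.le_sqrt_of_sq_le (le_add_of_nonneg_left (sq_nonneg _))
  have hHC : CauchySeq H := by
    rw [Metric.cauchySeq_iff]
    intro ε hε
    obtain ⟨N, hN⟩ := Metric.cauchySeq_iff.1 hφ.cauchySeq ε hε
    refine ⟨N, fun m hm k hk => lt_of_le_of_lt ?_ (hN m hm k hk)⟩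
    rw [dist_eq_norm, dist_eq_norm, ← ofTest_sub]
    refine le_trans (le_of_eq ?_) (hS_le _)
    rw [hS, sobolevSeminorm_apply, l2norm_eq_toReal (memLp_fourier _ hα.le),
      ← Lp.norm_toLp _ (memLp_fourier _ hα.le)]
    congr 1
    change MemLp.toLp _ _ - MemLp.toLp _ _ = _
    rw [← MemLp.toLp_sub]
    congr 1
    funext ξ
    simp only [Pi.sub_apply, fourier_sub, smul_sub]
  obtain ⟨h, hH⟩ := cauchySeq_tendsto_of_complete hHC
  have hzero : h = 0 := by
    -- A subsequence of a subsequence, so that both almost everywhere limits hold along the same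
    -- indices.
    obtain ⟨k₁, hk₁, hae₁⟩ := (tendstoInMeasure_of_tendsto_Lp hF).exists_seq_tendsto_ae
    obtain ⟨k₂, hk₂, hae₂⟩ := (tendstoInMeasure_of_tendsto_Lp
      (hH.comp hk₁.tendsto_atTop)).exists_seq_tendsto_ae
    have e1 : ∀ᵐ ξ, ∀ k, F k ξ = fourier (φ k) ξ :=
      ae_all_iff.2 fun k => MemLp.coeFn_toLp _
    have e2 : ∀ᵐ ξ, ∀ k, H k ξ = ‖ξ‖ ^ α • fourier (φ k) ξ :=
      ae_all_iff.2 fun k => MemLp.coeFn_toLp _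
    refine Lp.ext ?_
    filter_upwards [hae₁, hae₂, e1, e2, Lp.coeFn_zero ℂ 2 (volume : Measure E3)]
      with ξ h1 h2 h3 h4 h5
    rw [h5] at h1 ⊢
    have h6 := (h1.comp hk₂.tendsto_atTop).const_smul (‖ξ‖ ^ α)
    rw [Pi.zero_apply, smul_zero] at h6
    refine tendsto_nhds_unique h2 (h6.congr fun k => ?_)
    simp only [Function.comp_apply, h3, h4]
  rw [hzero] at hH
  have hSlim : Filter.Tendsto (fun k => S (φ k)) Filter.atTop (nhds 0) := by
    rw [tendsto_zero_iff_norm_tendsto_zero] at hH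
    refine hH.congr fun k => ?_
    rw [hS, sobolevSeminorm_apply, l2norm_eq_toReal (memLp_fourier _ hα.le)]
    exact Lp.norm_toLp _ _
  refine tendsto_nhds_unique hφ ?_
  rw [tendsto_zero_iff_norm_tendsto_zero] at hL2 ⊢
  have := ((hL2.pow 2).add (hSlim.pow 2)).sqrt
  simp only [ne_eq, OfNat.ofNat_ne_zero, not_false_eq_true, zero_pow, add_zero,
    Real.sqrt_zero] at this
  refine this.congr fun k => ?_
  rw [norm_ofTest, norm_testToL2]

end sobolev

/-! ### The regularized Fourier symbol -/

section symbol

/-- The regularized Fourier symbol `(ε + iw)^{-γ} (iw)^n`. -/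
def symbol (γ : ℝ) (n : ℕ) (ε w : ℝ) : ℂ :=
  (1 / ((ε : ℂ) + w * Complex.I)) ^ (γ : ℂ) * (w * Complex.I) ^ n

variable {γ : ℝ} {n : ℕ}

/-- Since |ε + iw| ≥ |w|, regularization can only decrease the modulus. The bound is uniform in ε
and serves both as energy estimate and as dominating function. -/
theorem norm_symbol_sq_le (hγ : 0 < γ) (hn : n ≠ 0) (ε w : ℝ) :
    ‖symbol γ n ε w‖ ^ 2 ≤ |w| ^ (2 * (n - γ)) := by
  rcases eq_or_ne w 0 with rfl | hw
  · have : symbol γ n ε 0 = 0 := by simp [symbol, hn]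
    rw [this]
    simp only [norm_zero, ne_eq, OfNat.ofNat_ne_zero, not_false_eq_true, zero_pow]
    positivity
  have hw' : 0 < |w| := abs_pos.2 hw
  have h1 : |w| ≤ ‖(ε : ℂ) + w * Complex.I‖ := by
    simpa using Complex.abs_im_le_norm ((ε : ℂ) + w * Complex.I)
  have h2 : ‖1 / ((ε : ℂ) + w * Complex.I)‖ ≤ |w|⁻¹ := by
    rw [norm_div, norm_one, one_div]
    exact inv_anti₀ hw' h1
  have h3 : ‖(1 / ((ε : ℂ) + w * Complex.I)) ^ (γ : ℂ)‖ ≤ |w| ^ (-γ) := by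
    rw [Complex.norm_cpow_real, Real.rpow_neg hw'.le, ← Real.inv_rpow hw'.le]
    exact Real.rpow_le_rpow (norm_nonneg _) h2 hγ.le
  have h4 : ‖((w : ℂ) * Complex.I) ^ n‖ = |w| ^ n := by simp
  have h5 : |w| ^ (2 * (n - γ)) = (|w| ^ (-γ) * |w| ^ n) ^ 2 := by
    rw [← Real.rpow_natCast |w| n, ← Real.rpow_add hw', ← Real.rpow_mul_natCast hw'.le]
    congr 1
    push_cast
    ring
  rw [h5, symbol, norm_mul, h4]
  gcongr

/-- Positivity of ε keeps the base of the complex power off the branch cut, where conjugation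
commutes with the power. -/
theorem conj_symbol_neg {ε : ℝ} (hε : 0 < ε) (w : ℝ) :
    (starRingEnd ℂ) (symbol γ n ε (-w)) = symbol γ n ε w := by
  have hz : 1 / ((ε : ℂ) + (-w : ℝ) * Complex.I) ∈ Complex.slitPlane := by
    left
    rw [one_div, Complex.inv_re]
    refine div_pos (by simpa using hε) (Complex.normSq_pos.2 fun h => ?_)
    have := congrArg Complex.re h
    simp at this
    exact hε.ne' this
  unfold symbol
  have h := Complex.conj_cpow _ (γ : ℂ) (Complex.slitPlane_arg_ne_pi hz)
  rw [Complex.conj_ofReal] at h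
  rw [map_mul, map_pow, ← h]
  simp

/-- The limit base 1/(iw) has argument ∓π/2, so the square of its γ-th power has argument ∓πγ, while
(iw)^{2n} contributes (-1)^n. Cosine is even, so the sign of w disappears. At w = 0 the condition γ
< n makes the limit zero. -/
theorem tendsto_re_symbol_sq (hγ : γ < n) (hn : n ≠ 0) (w : ℝ) :
    Filter.Tendsto (fun ε => (symbol γ n ε w ^ 2).re) (nhdsWithin 0 (Set.Ioi 0))
      (nhds ((-1) ^ n * Real.cos (Real.pi * γ) * |w| ^ (2 * (n - γ)))) := by
  rcases eq_or_ne w 0 with rfl | hw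
  · have h0 : (2 * ((n : ℝ) - γ)) ≠ 0 := by linarith
    have : ∀ ε, symbol γ n ε 0 = 0 := by simp [symbol, hn]
    simp [this, Real.zero_rpow h0]
  have hw' : 0 < |w| := abs_pos.2 hw
  have hwI : (w : ℂ) * Complex.I ≠ 0 := by simp [hw]
  have hslit : 1 / ((w : ℂ) * Complex.I) ∈ Complex.slitPlane := by
    right
    simp [Complex.inv_im, hw]
  have hlim : Filter.Tendsto (fun ε : ℝ => (symbol γ n ε w ^ 2).re) (nhdsWithin 0 (Set.Ioi 0))
      (nhds (((1 / ((w : ℂ) * Complex.I)) ^ (γ : ℂ) * (w * Complex.I) ^ n) ^ 2).re) := by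
    refine (Complex.continuous_re.tendsto _).comp (Filter.Tendsto.pow ?_ 2)
    refine Filter.Tendsto.mul_const _ ?_
    refine Filter.Tendsto.cpow ?_ tendsto_const_nhds hslit
    refine Filter.Tendsto.div tendsto_const_nhds ?_ hwI
    have : Continuous fun ε : ℝ => (ε : ℂ) + w * Complex.I := by fun_prop
    simpa using (this.tendsto 0).mono_left nhdsWithin_le_nhds
  convert! hlim using 2
  -- Here σ is minus the sign of `w`.
  have hlog : ∃ σ : ℝ, (σ = 1 ∨ σ = -1) ∧ Complex.log (1 / ((w : ℂ) * Complex.I)) =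
      ((-Real.log |w| : ℝ) : ℂ) + σ * (Real.pi / 2) * Complex.I := by
    rcases lt_or_gt_of_ne hw with h | h
    · refine ⟨1, Or.inl rfl, ?_⟩
      have : 1 / ((w : ℂ) * Complex.I) = ((|w|⁻¹ : ℝ) : ℂ) * Complex.I := by
        rw [abs_of_neg h]
        push_cast
        have : (w : ℂ) ≠ 0 := by exact_mod_cast hw
        field_simp
        simp
      rw [this, Complex.log_ofReal_mul (by positivity) Complex.I_ne_zero, Complex.log_I,
        Real.log_inv]
      push_cast
      ring
    · refine ⟨-1, Or.inr rfl, ?_⟩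
      have : 1 / ((w : ℂ) * Complex.I) = ((|w|⁻¹ : ℝ) : ℂ) * -Complex.I := by
        rw [abs_of_pos h]
        push_cast
        have : (w : ℂ) ≠ 0 := by exact_mod_cast hw
        field_simp
        simp
      rw [this, Complex.log_ofReal_mul (by positivity) (by simp), Complex.log_neg_I,
        Real.log_inv]
      push_cast
      ring
  obtain ⟨σ, hσ, hlog⟩ := hlog
  have hcp : ((1 / ((w : ℂ) * Complex.I)) ^ (γ : ℂ)) ^ 2 =
      ((|w| ^ (-(2 * γ)) : ℝ) : ℂ) * Complex.exp ((σ * (Real.pi * γ) : ℝ) * Complex.I) := by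
    rw [Complex.cpow_def_of_ne_zero (one_div_ne_zero hwI), hlog, ← Complex.exp_nat_mul,
      Real.rpow_def_of_pos hw', Complex.ofReal_exp, ← Complex.exp_add]
    congr 1
    push_cast
    ring
  have hpw : (((w : ℂ) * Complex.I) ^ n) ^ 2 = (((-1) ^ n * |w| ^ (2 * n) : ℝ) : ℂ) := by
    rw [← pow_mul, mul_comm n 2, mul_pow, pow_mul Complex.I, Complex.I_sq]
    have : |w| ^ (2 * n) = w ^ (2 * n) := by rw [pow_mul, pow_mul, sq_abs]
    rw [this]
    push_cast
    ring
  have hcos : Real.cos (σ * (Real.pi * γ)) = Real.cos (Real.pi * γ) := by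
    rcases hσ with rfl | rfl <;> simp
  have hrp : |w| ^ (2 * (n - γ)) = |w| ^ (-(2 * γ)) * |w| ^ (2 * n) := by
    rw [← Real.rpow_natCast, ← Real.rpow_add hw']
    congr 1
    push_cast
    ring
  rw [mul_pow, hcp, hpw, Complex.re_mul_ofReal, Complex.re_ofReal_mul,
    Complex.exp_ofReal_mul_I_re, hcos, hrp]
  ring

end symbol

/-! ### The exponentially damped kernel and its transform -/

section kernel

variable {β ε : ℝ}

/-- The one-sided kernel `s ↦ s₊^{-β}` with exponential damping. -/
def dampedKern (β ε : ℝ) (s : ℝ) : ℝ := kern β s * Real.exp (-(ε * s))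

theorem kern_nonneg (β s : ℝ) : 0 ≤ kern β s :=
  Set.indicator_nonneg (fun _ ht => one_div_nonneg.2 (Real.rpow_nonneg (le_of_lt ht) _)) s

theorem norm_dampedKern_le (hε : 0 ≤ ε) (s : ℝ) : ‖dampedKern β ε s‖ ≤ kern β s := by
  rw [dampedKern, norm_mul, Real.norm_of_nonneg (kern_nonneg β s),
    Real.norm_of_nonneg (Real.exp_pos _).le]
  by_cases hs : 0 < s
  · refine mul_le_of_le_one_right (kern_nonneg β s) (Real.exp_le_one_iff.2 ?_)
    have : 0 ≤ ε * s := by positivity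
    linarith
  · simp [kern, hs]

theorem tendsto_dampedKern (β s : ℝ) :
    Filter.Tendsto (fun ε => dampedKern β ε s) (nhdsWithin 0 (Set.Ioi 0)) (nhds (kern β s)) := by
  have : Continuous fun ε : ℝ => dampedKern β ε s := by
    unfold dampedKern
    fun_prop
  simpa [dampedKern] using (this.tendsto 0).mono_left nhdsWithin_le_nhds

/-- The exponent -β is written as (1 - β) - 1 to match the Gamma integrand with γ = 1 - β. -/
theorem dampedKern_eq_indicator (β ε : ℝ) : dampedKern β ε =
    (Set.Ioi 0).indicator fun s => s ^ ((1 - β) - 1) * Real.exp (-(ε * s)) := by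
  funext s
  by_cases hs : s ∈ Set.Ioi (0 : ℝ)
  · rw [dampedKern, kern, Set.indicator_of_mem hs, Set.indicator_of_mem hs, one_div,
      ← Real.rpow_neg (le_of_lt hs)]
    ring_nf
  · rw [dampedKern, kern, Set.indicator_of_notMem hs, Set.indicator_of_notMem hs, zero_mul]

theorem integrable_dampedKern (hβ : β < 1) (hε : 0 < ε) : Integrable (dampedKern β ε) := by
  rw [dampedKern_eq_indicator, integrable_indicator_iff measurableSet_Ioi]
  have h := integrableOn_rpow_mul_exp_neg_mul_rpow (p := 1) (s := (1 - β) - 1) (b := ε)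
    (by linarith) one_pos hε
  simpa using h

theorem integral_dampedKern_mul_cexp (hβ : β < 1) (hε : 0 < ε) (w : ℝ) :
    ∫ s : ℝ, (dampedKern β ε s : ℂ) * Complex.exp (-(w * Complex.I) * s) =
      (1 / ((ε : ℂ) + w * Complex.I)) ^ ((1 - β : ℝ) : ℂ) * Real.Gamma (1 - β) := by
  rw [← integral_rpow_mul_cexp_neg_mul_Ioi (by linarith) (by simpa using hε),
    ← integral_indicator measurableSet_Ioi]
  congr 1
  funext s
  rw [dampedKern_eq_indicator]
  by_cases hs : s ∈ Set.Ioi (0 : ℝ)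
  · rw [Set.indicator_of_mem hs, Set.indicator_of_mem hs, Complex.ofReal_mul, mul_assoc,
      Complex.ofReal_exp, ← Complex.exp_add]
    congr 2
    push_cast
    ring
  · rw [Set.indicator_of_notMem hs, Set.indicator_of_notMem hs, Complex.ofReal_zero, zero_mul]

theorem integral_dampedKern_neg_mul_cexp (hβ : β < 1) (hε : 0 < ε) (w : ℝ) :
    ∫ s : ℝ, (dampedKern β ε (-s) : ℂ) * Complex.exp (-(w * Complex.I) * s) =
      (1 / ((ε : ℂ) + (-w : ℝ) * Complex.I)) ^ ((1 - β : ℝ) : ℂ) * Real.Gamma (1 - β) := by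
  rw [← integral_dampedKern_mul_cexp hβ hε, ← integral_neg_eq_self]
  congr 1
  funext s
  rw [neg_neg]
  congr 2
  push_cast
  ring

end kernel

/-! ### Partial derivatives of test functions and their transforms -/

section testDeriv

open FourierTransform LineDeriv

variable {a b : Fin 3 → ℝ}

/-- The `n`-th derivative of a test function in the `i`-th variable. -/
def iterPartial (n : ℕ) (i : Fin 3) (φ : 𝓓(box a b, ℝ)) : 𝓓(box a b, ℝ) :=
  (∂_{(EuclideanSpace.single i (1 : ℝ) : E3)})^[n] φ

theorem lineDeriv_test_apply (φ : 𝓓(box a b, ℝ)) (v x : E3) :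
    (∂_{v} φ : 𝓓(box a b, ℝ)) x = fderiv ℝ φ x v := by
  rw [TestFunction.lineDerivOp_eq_lineDerivCLM ℝ, TestFunction.lineDerivCLM_apply_of_le (by simp)]
  exact (φ.contDiff.differentiable (by simp) x).lineDeriv_eq_fderiv

theorem iteratedDeriv_slice_eq (n : ℕ) (i : Fin 3) (φ : 𝓓(box a b, ℝ)) (x : E3) (t : ℝ) :
    iteratedDeriv n (fun s => φ (subst x i s)) t = iterPartial n i φ (subst x i t) := by
  induction n generalizing φ with
  | zero => simp [iterPartial]
  | succ n ih =>
    rw [iteratedDeriv_succ', iterPartial, Function.iterate_succ_apply]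
    refine Eq.trans ?_ (ih _)
    congr 1
    funext s
    rw [lineDeriv_test_apply]
    exact ((φ.contDiff.differentiable (by simp) _).hasFDerivAt.comp_hasDerivAt s
      (hasDerivAt_subst x i s)).deriv

theorem toSchwartz_lineDeriv (φ : 𝓓(box a b, ℝ)) (v : E3) :
    toSchwartz (∂_{v} φ) = ∂_{v} (toSchwartz φ) := by
  ext x
  rw [SchwartzMap.lineDerivOp_apply_eq_fderiv]
  change (((∂_{v} φ : 𝓓(box a b, ℝ)) x : ℝ) : ℂ) = fderiv ℝ (fun y => (φ y : ℂ)) x v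
  rw [lineDeriv_test_apply]
  have h := (Complex.ofRealCLM.hasFDerivAt).comp x
    (φ.contDiff.differentiable (by simp) x).hasFDerivAt
  rw [show (fun y => (φ y : ℂ)) = Complex.ofRealCLM ∘ φ from rfl, h.fderiv]
  rfl

theorem fourier_iterPartial (n : ℕ) (i : Fin 3) (φ : 𝓓(box a b, ℝ)) (ξ : E3) :
    𝓕 (toSchwartz (iterPartial n i φ)) ξ =
      ((2 * Real.pi * ξ i : ℝ) * Complex.I) ^ n * 𝓕 (toSchwartz φ) ξ := by
  induction n generalizing φ with
  | zero => simp [iterPartial]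
  | succ n ih =>
    rw [iterPartial, Function.iterate_succ_apply]
    refine (ih _).trans ?_
    rw [toSchwartz_lineDeriv, SchwartzMap.fourier_lineDerivOp_eq]
    have : (fun y : E3 => (inner ℝ y (EuclideanSpace.single i (1 : ℝ)) : ℝ)).HasTemperateGrowth :=
      ((innerSL ℝ).flip _).hasTemperateGrowth
    rw [smul_apply, SchwartzMap.smulLeftCLM_apply_apply this,
      EuclideanSpace.inner_single_right]
    simp only [smul_eq_mul, Complex.real_smul]
    push_cast
    simp
    ring

/-- The derivatives fall on the smooth factor of the convolution, and replacing the i-th coordinate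
by `x i - s` is translation by `-s` along that axis. -/
theorem convDeriv_eq_lineConv {k : ℝ → ℝ} (hk : LocallyIntegrable k) (n : ℕ) (i : Fin 3)
    (φ : 𝓓(box a b, ℝ)) (x : E3) :
    convDeriv k n i φ x = lineConv k (EuclideanSpace.single i 1) (iterPartial n i φ) x := by
  unfold convDeriv
  rw [iteratedDeriv_convolution hk n _ (contDiff_slice φ.contDiff x i)
    (hasCompactSupport_slice φ.hasCompactSupport x i)]
  simp only [convolution, iteratedDeriv_slice_eq, lineConv]
  congr 1
  funext s
  have : subst x i (x i - s) = x - s • EuclideanSpace.single i (1 : ℝ) := by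
    ext j
    by_cases h : j = i
    · subst h; simp [subst]
    · simp [subst, h]
  rw [this]
  rfl

end testDeriv

/-! ### Energies of the one-sided convolutions -/

section energy_identities

open FourierTransform

/-- The Cauchy–Schwarz inequality for square integrable functions. -/
theorem sq_integral_mul_le {X : Type*} [MeasurableSpace X] {μ : Measure X} {f g : X → ℝ}
    (hf : MemLp f 2 μ) (hg : MemLp g 2 μ) :
    (∫ x, f x * g x ∂μ) ^ 2 ≤ (∫ x, f x ^ 2 ∂μ) * ∫ x, g x ^ 2 ∂μ := by
  have key : ∀ {u v : X → ℝ} (hu : MemLp u 2 μ) (hv : MemLp v 2 μ),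
      inner ℝ (hu.toLp u) (hv.toLp v) = ∫ x, u x * v x ∂μ := by
    intro u v hu hv
    rw [L2.inner_def]
    refine integral_congr_ae ?_
    filter_upwards [hu.coeFn_toLp, hv.coeFn_toLp] with x h1 h2
    rw [h1, h2]
    simp [mul_comm]
  have h := real_inner_mul_inner_self_le (hf.toLp f) (hg.toLp g)
  simpa only [key, sq] using h

variable {a b : Fin 3 → ℝ}

theorem isFiniteMeasure_boxMeasure (a b : Fin 3 → ℝ) : IsFiniteMeasure (boxMeasure a b) := by
  refine isFiniteMeasure_restrict.2 (ne_of_lt ?_)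
  have hK : IsCompact ((EuclideanSpace.equiv (Fin 3) ℝ) ⁻¹'
      (Set.univ.pi fun i => Set.Icc (a i) (b i))) :=
    (EuclideanSpace.equiv (Fin 3) ℝ).toHomeomorph.isCompact_preimage.2
      (isCompact_univ_pi fun i => isCompact_Icc)
  refine (measure_mono ?_).trans_lt hK.measure_lt_top
  intro x hx j _
  exact Set.Ioo_subset_Icc_self (hx j)

theorem test_eq_zero (ψ : 𝓓(box a b, ℝ)) {x : E3} (hx : x ∉ box a b) : ψ x = 0 := by
  by_contra hne
  exact hx (ψ.tsupport_subset (subset_tsupport _ hne))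

theorem exists_test_bound (ψ : 𝓓(box a b, ℝ)) : ∃ M, ∀ x, ‖ψ x‖ ≤ M :=
  ψ.continuous.bounded_above_of_compact_support ψ.hasCompactSupport

/-! ### Removing the damping on the box -/

section limit

variable {k : ℝ → ℝ} {K : ℝ → ℝ → ℝ} {i : Fin 3} {ψ : 𝓓(box a b, ℝ)}

theorem test_shift_eq_zero {x : E3} (hx : x ∈ box a b) {s : ℝ}
    (hs : s ∉ Set.Icc (-(b i - a i)) (b i - a i)) :
    ψ (x - s • EuclideanSpace.single i (1 : ℝ)) = 0 := by
  refine test_eq_zero ψ fun h => hs ?_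
  have h1 := h i
  have h2 := hx i
  simp only [PiLp.sub_apply, PiLp.smul_apply, PiLp.single_apply, if_true, smul_eq_mul,
    mul_one, Set.mem_Ioo] at h1 h2
  constructor <;> linarith

/-- Dominated convergence, in `s` and then in `x`. For `x` in the box only |s| ≤ bᵢ - aᵢ
contributes, so local integrability of the undamped kernel is enough to dominate. -/
theorem tendsto_integral_lineConv_sq (hk : LocallyIntegrable k)
    (hK : ∀ ε, 0 < ε → Integrable (K ε)) (hle : ∀ ε, 0 < ε → ∀ s, ‖K ε s‖ ≤ ‖k s‖)
    (hlim : ∀ s, Filter.Tendsto (fun ε => K ε s) (nhdsWithin 0 (Set.Ioi 0)) (nhds (k s))) :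
    Filter.Tendsto
      (fun ε => ∫ x, lineConv (K ε) (EuclideanSpace.single i 1) ψ x ^ 2 ∂(boxMeasure a b))
      (nhdsWithin 0 (Set.Ioi 0))
      (nhds (∫ x, lineConv k (EuclideanSpace.single i 1) ψ x ^ 2 ∂(boxMeasure a b))) := by
  have := isFiniteMeasure_boxMeasure a b
  obtain ⟨M, hM⟩ := exists_test_bound ψ
  have hM0 : 0 ≤ M := (norm_nonneg _).trans (hM 0)
  set g : ℝ → ℝ := (Set.Icc (-(b i - a i)) (b i - a i)).indicator fun s => ‖k s‖ * M with hg
  have hgi : Integrable g := by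
    rw [hg, integrable_indicator_iff measurableSet_Icc]
    exact ((locallyIntegrable_iff.1 hk) _ isCompact_Icc).norm.mul_const M
  have hbound : ∀ ε, 0 < ε → ∀ x ∈ box a b, ∀ s,
      ‖K ε s * ψ (x - s • EuclideanSpace.single i (1 : ℝ))‖ ≤ g s := by
    intro ε hε x hx s
    by_cases hs : s ∈ Set.Icc (-(b i - a i)) (b i - a i)
    · rw [hg, Set.indicator_of_mem hs, norm_mul]
      exact mul_le_mul (hle ε hε s) (hM _) (norm_nonneg _) (norm_nonneg _)
    · rw [hg, Set.indicator_of_notMem hs, test_shift_eq_zero hx hs, mul_zero, norm_zero]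
  refine tendsto_integral_filter_of_dominated_convergence (fun _ => (∫ s, g s) ^ 2) ?_ ?_
    (integrable_const _) ?_
  · filter_upwards [self_mem_nhdsWithin] with ε hε
    exact ((continuous_lineConv (hK ε hε) ψ.continuous hM).pow 2).aestronglyMeasurable
  · filter_upwards [self_mem_nhdsWithin] with ε hε
    filter_upwards [ae_mem_box] with x hx
    rw [norm_pow]
    gcongr
    exact norm_integral_le_of_norm_le hgi (Filter.Eventually.of_forall (hbound ε hε x hx))
  · filter_upwards [ae_mem_box] with x hx
    refine Filter.Tendsto.pow ?_ 2
    refine tendsto_integral_filter_of_dominated_convergence g ?_ ?_ hgi ?_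
    · filter_upwards [self_mem_nhdsWithin] with ε hε
      exact (hK ε hε).1.mul (ψ.continuous.comp (by fun_prop)).aestronglyMeasurable
    · filter_upwards [self_mem_nhdsWithin] with ε hε
      exact Filter.Eventually.of_forall (hbound ε hε x hx)
    · exact Filter.Eventually.of_forall fun s => (hlim s).mul_const _

end limit

/-! ### Parseval for the damped convolutions -/

section parseval

variable {K K₁ K₂ : ℝ → ℝ} {v : E3} {ψ : 𝓓(box a b, ℝ)}

theorem integrable_test (ψ : 𝓓(box a b, ℝ)) : Integrable (ψ : E3 → ℝ) :=
  ψ.continuous.integrable_of_hasCompactSupport ψ.hasCompactSupport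

/-- The convolution is both bounded and integrable, hence square integrable. -/
theorem memLp_lineConv (hK : Integrable K) : MemLp (lineConv K v ψ) 2 volume := by
  obtain ⟨M, hM⟩ := exists_test_bound ψ
  have hc := continuous_lineConv (v := v) hK ψ.continuous hM
  have hi := integrable_lineConv (v := v) hK ψ.continuous (integrable_test ψ)
  rw [memLp_two_iff_integrable_sq hc.aestronglyMeasurable]
  simp only [sq]
  refine hi.bdd_mul (c := ∫ s, ‖K s‖ * M) hc.aestronglyMeasurable
    (Filter.Eventually.of_forall fun x => ?_)
  refine norm_integral_le_of_norm_le (hK.norm.mul_const M) (Filter.Eventually.of_forall fun s => ?_)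
  rw [norm_mul]
  exact mul_le_mul_of_nonneg_left (hM _) (norm_nonneg _)

/-- The transform is a Schwartz function times a multiplier bounded by the L¹ norm of `K`. -/
theorem integrable_fourier_lineConv (hK : Integrable K) :
    Integrable (𝓕 fun x => (lineConv K v ψ x : ℂ)) := by
  have hi := (integrable_lineConv (v := v) hK ψ.continuous (integrable_test ψ)).ofReal (𝕜 := ℂ)
  have hc : Continuous (𝓕 fun x => (lineConv K v ψ x : ℂ)) :=
    VectorFourier.fourierIntegral_continuous Real.continuous_fourierChar
      (by exact continuous_inner) hi
  refine ((𝓕 (toSchwartz ψ)).integrable.norm.const_mul (∫ s, ‖K s‖)).mono'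
    hc.aestronglyMeasurable (Filter.Eventually.of_forall fun ξ => ?_)
  rw [fourier_lineConv hK ψ.continuous (integrable_test ψ), norm_mul]
  refine mul_le_mul_of_nonneg_right ?_ (norm_nonneg _)
  refine norm_integral_le_of_norm_le hK.norm (Filter.Eventually.of_forall fun s => ?_)
  rw [norm_mul, ← neg_mul, mul_right_comm, ← Complex.ofReal_neg, ← Complex.ofReal_mul,
    Complex.norm_exp_ofReal_mul_I, mul_one, Complex.norm_real]

theorem integral_lineConv_mul (h₁ : Integrable K₁) (h₂ : Integrable K₂) :
    ∫ x, lineConv K₁ v ψ x * lineConv K₂ v ψ x =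
      ∫ ξ, (inner ℂ (𝓕 (fun x => (lineConv K₁ v ψ x : ℂ)) ξ)
        (𝓕 (fun x => (lineConv K₂ v ψ x : ℂ)) ξ) : ℂ).re := by
  obtain ⟨M, hM⟩ := exists_test_bound ψ
  have hi : ∀ {K : ℝ → ℝ}, Integrable K → Integrable fun x => (lineConv K v ψ x : ℂ) :=
    fun hK => (integrable_lineConv hK ψ.continuous (integrable_test ψ)).ofReal
  have hc := Complex.continuous_ofReal.comp (continuous_lineConv (v := v) h₂ ψ.continuous hM)
  have h := integral_inner_fourier_eq (hi h₁) (hi h₂) hc (integrable_fourier_lineConv h₂)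
  have hint : Integrable fun ξ => (inner ℂ (𝓕 (fun x => (lineConv K₁ v ψ x : ℂ)) ξ)
      (𝓕 (fun x => (lineConv K₂ v ψ x : ℂ)) ξ) : ℂ) := by
    refine ((integrable_fourier_lineConv (v := v) (ψ := ψ) h₂).norm.const_mul
      (∫ x, ‖(lineConv K₁ v ψ x : ℂ)‖)).mono' ?_ (Filter.Eventually.of_forall fun ξ => ?_)
    · exact (integrable_fourier_lineConv h₁).1.inner (integrable_fourier_lineConv h₂).1
    · refine (norm_inner_le_norm _ _).trans (mul_le_mul_of_nonneg_right ?_ (norm_nonneg _))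
      exact VectorFourier.norm_fourierIntegral_le_integral_norm _ _ _ _ _
  have h2 := integral_re (𝕜 := ℂ) hint
  simp only [RCLike.re_eq_complex_re] at h2
  rw [h2, h, ← Complex.ofReal_re (∫ x, lineConv K₁ v ψ x * lineConv K₂ v ψ x),
    ← integral_complex_ofReal]
  congr 2
  funext x
  simp [mul_comm]

end parseval

/-! ### Two-sided bounds for the directional energies -/

section energy

variable {α β ε : ℝ} {n : ℕ} {i : Fin 3} (φ : 𝓓(box a b, ℝ))

/-- The partial Sobolev energy of order `α` in the `i`-th variable. -/
def partialEnergy (α : ℝ) (i : Fin 3) (φ : 𝓓(box a b, ℝ)) : ℝ :=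
  ∫ ξ : E3, |2 * Real.pi * ξ i| ^ (2 * α) * ‖𝓕 (toSchwartz φ) ξ‖ ^ 2

theorem integrable_partialEnergy (hα : 0 ≤ α) (i : Fin 3) :
    Integrable fun ξ : E3 => |2 * Real.pi * ξ i| ^ (2 * α) * ‖𝓕 (toSchwartz φ) ξ‖ ^ 2 := by
  have h := (memLp_pow_mul_schwartz hα (𝓕 (toSchwartz φ)))
  rw [memLp_two_iff_integrable_sq_norm h.1] at h
  have hc : Continuous fun ξ : E3 =>
      |2 * Real.pi * ξ i| ^ (2 * α) * ‖𝓕 (toSchwartz φ) ξ‖ ^ 2 := by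
    refine Continuous.mul ?_ ((𝓕 (toSchwartz φ)).continuous.norm.pow 2)
    exact Continuous.rpow_const (by fun_prop) fun _ => Or.inr (by positivity)
  refine (h.const_mul ((2 * Real.pi) ^ (2 * α))).mono' hc.aestronglyMeasurable
    (Filter.Eventually.of_forall fun ξ => ?_)
  rw [Real.norm_of_nonneg (by positivity), norm_smul, mul_pow,
    Real.norm_of_nonneg (by positivity), ← Real.rpow_mul_natCast (norm_nonneg _), ← mul_assoc,
    mul_comm α]
  refine mul_le_mul_of_nonneg_right ?_ (by positivity)
  rw [Nat.cast_ofNat, ← Real.mul_rpow (by positivity) (by positivity), abs_mul,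
    abs_of_pos (by positivity : 0 < 2 * Real.pi)]
  refine Real.rpow_le_rpow (by positivity) ?_ (by positivity)
  exact mul_le_mul_of_nonneg_left (PiLp.norm_apply_le ξ i) (by positivity)

theorem partialEnergy_nonneg : 0 ≤ partialEnergy α i φ :=
  integral_nonneg fun _ => by positivity

theorem fourier_left (hβ : β < 1) (hε : 0 < ε) (ξ : E3) :
    𝓕 (fun x => (lineConv (dampedKern β ε) (EuclideanSpace.single i 1)
      (iterPartial n i φ) x : ℂ)) ξ = Real.Gamma (1 - β) *
        symbol (1 - β) n ε (2 * Real.pi * ξ i) * 𝓕 (toSchwartz φ) ξ := by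
  rw [fourier_lineConv (integrable_dampedKern hβ hε) (iterPartial n i φ).continuous
    (integrable_test _), integral_dampedKern_mul_cexp hβ hε]
  have h := fourier_iterPartial n i φ ξ
  rw [SchwartzMap.fourier_coe] at h
  change 𝓕 (fun x => (iterPartial n i φ x : ℂ)) ξ = _ at h
  rw [h, EuclideanSpace.inner_single_left, symbol]
  simp only [map_one, one_mul]
  ring

/-- Reflecting the kernel changes w to -w in the power; rewriting (iw)^n as (-1)^n(-iw)^n makes the
whole expression the symbol at -w. -/
theorem fourier_right (hβ : β < 1) (hε : 0 < ε) (ξ : E3) :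
    𝓕 (fun x => (lineConv (fun s => dampedKern β ε (-s)) (EuclideanSpace.single i 1)
      (iterPartial n i φ) x : ℂ)) ξ = Real.Gamma (1 - β) *
        ((-1) ^ n * symbol (1 - β) n ε (-(2 * Real.pi * ξ i))) * 𝓕 (toSchwartz φ) ξ := by
  rw [fourier_lineConv (integrable_dampedKern hβ hε).comp_neg (iterPartial n i φ).continuous
    (integrable_test _), integral_dampedKern_neg_mul_cexp hβ hε]
  have h := fourier_iterPartial n i φ ξ
  rw [SchwartzMap.fourier_coe] at h
  change 𝓕 (fun x => (iterPartial n i φ x : ℂ)) ξ = _ at h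
  rw [h, EuclideanSpace.inner_single_left, symbol]
  simp only [map_one, one_mul, Complex.ofReal_neg, neg_mul]
  rw [neg_pow (((2 * Real.pi * ξ i : ℝ) : ℂ) * Complex.I) n]
  have : ((-1 : ℂ) ^ n) * (-1) ^ n = 1 := by rw [← mul_pow]; simp
  linear_combination (-(Real.Gamma (1 - β)) * 𝓕 (toSchwartz φ) ξ *
    (((2 * Real.pi * ξ i : ℝ) : ℂ) * Complex.I) ^ n *
    (1 / ((ε : ℂ) + -(((2 * Real.pi * ξ i : ℝ) : ℂ) * Complex.I))) ^ ((1 - β : ℝ) : ℂ)) * this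

theorem integral_sq_le_of_fourier {K : ℝ → ℝ} (hK : Integrable K) (hα : 0 ≤ α) {v : E3}
    {ψ : 𝓓(box a b, ℝ)} {c : ℝ}
    (h : ∀ ξ, ‖𝓕 (fun x => (lineConv K v ψ x : ℂ)) ξ‖ ^ 2 ≤
      c * (|2 * Real.pi * ξ i| ^ (2 * α) * ‖𝓕 (toSchwartz φ) ξ‖ ^ 2)) :
    ∫ x, lineConv K v ψ x ^ 2 ≤ c * partialEnergy α i φ := by
  simp only [sq (lineConv K v ψ _)]
  rw [integral_lineConv_mul hK hK, partialEnergy, ← integral_const_mul]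
  refine integral_mono_of_nonneg (Filter.Eventually.of_forall fun ξ => ?_)
    ((integrable_partialEnergy φ hα i).const_mul c) (Filter.Eventually.of_forall fun ξ => ?_)
  · exact inner_self_nonneg (𝕜 := ℂ) (x := 𝓕 (fun x => (lineConv K v ψ x : ℂ)) ξ)
  · refine le_trans (le_of_eq ?_) (h ξ)
    exact inner_self_eq_norm_sq (𝕜 := ℂ) (𝓕 (fun x => (lineConv K v ψ x : ℂ)) ξ)

theorem integral_left_sq_le (hβ : β < 1) (hn : n ≠ 0) (hα : 0 ≤ α) (hαβ : α = n - (1 - β))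
    (hε : 0 < ε) :
    ∫ x, lineConv (dampedKern β ε) (EuclideanSpace.single i 1) (iterPartial n i φ) x ^ 2 ≤
      Real.Gamma (1 - β) ^ 2 * partialEnergy α i φ := by
  refine integral_sq_le_of_fourier φ (integrable_dampedKern hβ hε) hα fun ξ => ?_
  rw [fourier_left φ hβ hε, norm_mul, norm_mul, Complex.norm_real, mul_pow, mul_pow, mul_assoc,
    Real.norm_eq_abs, sq_abs, hαβ]
  gcongr
  exact norm_symbol_sq_le (by linarith) hn _ _

theorem integral_right_sq_le (hβ : β < 1) (hn : n ≠ 0) (hα : 0 ≤ α) (hαβ : α = n - (1 - β))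
    (hε : 0 < ε) :
    ∫ x, lineConv (fun s => dampedKern β ε (-s)) (EuclideanSpace.single i 1)
      (iterPartial n i φ) x ^ 2 ≤ Real.Gamma (1 - β) ^ 2 * partialEnergy α i φ := by
  refine integral_sq_le_of_fourier φ (integrable_dampedKern hβ hε).comp_neg hα fun ξ => ?_
  rw [fourier_right φ hβ hε, norm_mul, norm_mul, norm_mul, norm_pow, norm_neg, norm_one, one_pow,
    one_mul, Complex.norm_real, mul_pow, mul_pow, mul_assoc, Real.norm_eq_abs, sq_abs, hαβ,
    ← abs_neg (2 * Real.pi * ξ i)]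
  gcongr
  exact norm_symbol_sq_le (by linarith) hn _ _

/-- The transform of the right convolution involves the conjugate of the left symbol. Conjugating it
in Parseval's formula therefore produces the square of the symbol rather than its squared modulus,
and this is the source of the cosine. The two factors (-1)^n, from the right symbol and from the
limit, cancel. -/
theorem tendsto_integral_left_mul_right (hβ : β < 1) (hn : n ≠ 0) (hα : 0 < α)
    (hαβ : α = n - (1 - β)) :
    Filter.Tendsto (fun ε => ∫ x,
        lineConv (fun s => dampedKern β ε (-s)) (EuclideanSpace.single i 1) (iterPartial n i φ) x *
        lineConv (dampedKern β ε) (EuclideanSpace.single i 1) (iterPartial n i φ) x)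
      (nhdsWithin 0 (Set.Ioi 0))
      (nhds (Real.Gamma (1 - β) ^ 2 * Real.cos (Real.pi * (1 - β)) * partialEnergy α i φ)) := by
  have hpair : ∀ ε, 0 < ε → ∫ x,
        lineConv (fun s => dampedKern β ε (-s)) (EuclideanSpace.single i 1) (iterPartial n i φ) x *
        lineConv (dampedKern β ε) (EuclideanSpace.single i 1) (iterPartial n i φ) x =
      ∫ ξ, Real.Gamma (1 - β) ^ 2 * (-1) ^ n * ((symbol (1 - β) n ε (2 * Real.pi * ξ i) ^ 2).re *
        ‖𝓕 (toSchwartz φ) ξ‖ ^ 2) := by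
    intro ε hε
    rw [integral_lineConv_mul (integrable_dampedKern hβ hε).comp_neg (integrable_dampedKern hβ hε)]
    congr 1
    funext ξ
    rw [fourier_left φ hβ hε, fourier_right φ hβ hε, RCLike.inner_apply', map_mul, map_mul,
      map_mul, conj_symbol_neg hε, Complex.conj_ofReal, map_pow, map_neg, map_one]
    have e : Real.Gamma (1 - β) * ((-1) ^ n * symbol (1 - β) n ε (2 * Real.pi * ξ i)) *
        (starRingEnd ℂ) (𝓕 (toSchwartz φ) ξ) * (Real.Gamma (1 - β) *
        symbol (1 - β) n ε (2 * Real.pi * ξ i) * 𝓕 (toSchwartz φ) ξ) =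
        ((Real.Gamma (1 - β) ^ 2 * (-1) ^ n * ‖𝓕 (toSchwartz φ) ξ‖ ^ 2 : ℝ) : ℂ) *
          symbol (1 - β) n ε (2 * Real.pi * ξ i) ^ 2 := by
      have := Complex.conj_mul' (𝓕 (toSchwartz φ) ξ)
      push_cast
      rw [← this]
      ring
    rw [e, Complex.re_ofReal_mul]
    ring
  have hlim : Real.Gamma (1 - β) ^ 2 * Real.cos (Real.pi * (1 - β)) * partialEnergy α i φ =
      ∫ ξ : E3, Real.Gamma (1 - β) ^ 2 * (-1) ^ n * ((-1) ^ n * Real.cos (Real.pi * (1 - β)) *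
        |2 * Real.pi * ξ i| ^ (2 * α) * ‖𝓕 (toSchwartz φ) ξ‖ ^ 2) := by
    rw [partialEnergy, ← integral_const_mul]
    congr 1
    funext ξ
    have : ((-1 : ℝ) ^ n) * (-1) ^ n = 1 := by rw [← mul_pow]; simp
    linear_combination (-Real.Gamma (1 - β) ^ 2 * Real.cos (Real.pi * (1 - β)) *
      |2 * Real.pi * ξ i| ^ (2 * α) * ‖𝓕 (toSchwartz φ) ξ‖ ^ 2) * this
  rw [hlim]
  refine Filter.Tendsto.congr' (f₁ := fun ε => ∫ ξ : E3, Real.Gamma (1 - β) ^ 2 * (-1) ^ n *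
    ((symbol (1 - β) n ε (2 * Real.pi * ξ i) ^ 2).re * ‖𝓕 (toSchwartz φ) ξ‖ ^ 2)) ?_ ?_
  · filter_upwards [self_mem_nhdsWithin] with ε hε
    exact (hpair ε hε).symm
  refine tendsto_integral_filter_of_dominated_convergence (fun ξ => Real.Gamma (1 - β) ^ 2 *
    (|2 * Real.pi * ξ i| ^ (2 * α) * ‖𝓕 (toSchwartz φ) ξ‖ ^ 2)) ?_ ?_
    ((integrable_partialEnergy φ hα.le i).const_mul _) ?_
  · refine Filter.Eventually.of_forall fun ε => Measurable.aestronglyMeasurable ?_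
    have hm : Measurable fun ξ : E3 => 𝓕 (toSchwartz φ) ξ := (𝓕 (toSchwartz φ)).continuous.measurable
    unfold symbol
    refine Measurable.const_mul (Measurable.mul ?_ (hm.norm.pow_const 2)) _
    refine Complex.measurable_re.comp ?_
    fun_prop
  · refine Filter.Eventually.of_forall fun ε => Filter.Eventually.of_forall fun ξ => ?_
    rw [norm_mul, norm_mul, norm_mul, norm_pow, norm_pow, norm_pow, norm_neg, norm_one, one_pow,
      mul_one, norm_norm, Real.norm_eq_abs (Real.Gamma _), sq_abs]
    gcongr
    refine (Complex.abs_re_le_norm _).trans ?_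
    rw [norm_pow, hαβ]
    exact norm_symbol_sq_le (by linarith) hn _ _
  · refine Filter.Eventually.of_forall fun ξ => ?_
    refine Filter.Tendsto.const_mul _ (Filter.Tendsto.mul_const _ ?_)
    rw [hαβ]
    exact tendsto_re_symbol_sq (by linarith) hn _

/-- If both factors are nonzero, the line through `x` in direction `i` meets the box both behind and
ahead of `x`; then `x` lies between two points of the box, hence in it. -/
theorem left_mul_right_eq_zero {ψ : 𝓓(box a b, ℝ)} {x : E3} (hx : x ∉ box a b) :
    lineConv (fun s => dampedKern β ε (-s)) (EuclideanSpace.single i 1) ψ x *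
      lineConv (dampedKern β ε) (EuclideanSpace.single i 1) ψ x = 0 := by
  by_contra hne
  have hex : ∀ {K : ℝ → ℝ}, lineConv K (EuclideanSpace.single i 1) ψ x ≠ 0 → ∃ s, K s ≠ 0 ∧
      x - s • EuclideanSpace.single i (1 : ℝ) ∈ box a b := by
    intro K hK
    by_contra! hall
    refine hK ?_
    have : ∀ s, K s * ψ (x - s • EuclideanSpace.single i (1 : ℝ)) = 0 := fun s => by
      by_cases hs : K s = 0
      · rw [hs, zero_mul]
      · rw [test_eq_zero ψ (hall s hs), mul_zero]
    simp only [lineConv, this, integral_zero]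
  have hpos : ∀ {s}, dampedKern β ε s ≠ 0 → 0 < s := by
    intro s hs
    by_contra hneg
    exact hs (by simp [dampedKern, kern, hneg])
  obtain ⟨s, hs, h1⟩ := hex (left_ne_zero_of_mul hne)
  obtain ⟨t, ht, h2⟩ := hex (right_ne_zero_of_mul hne)
  refine hx fun j => ?_
  have h1j := h1 j
  have h2j := h2 j
  have hs' := hpos hs
  have ht' := hpos ht
  by_cases hj : j = i
  · subst hj
    simp only [PiLp.sub_apply, PiLp.smul_apply, PiLp.single_apply, if_true, smul_eq_mul,
      mul_one, Set.mem_Ioo] at h1j h2j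
    exact ⟨by linarith, by linarith⟩
  · simpa [hj] using h1j

/-- The argument common to both sides: `K` is the kernel being estimated and `K'` its reflection.
Cauchy–Schwarz on the box gives (cA)² ≤ (box energy of `k`)·A in the limit, and one factor A is
divided out. -/
theorem box_energy_bounds {k : ℝ → ℝ} {K K' : ℝ → ℝ → ℝ} {ψ : 𝓓(box a b, ℝ)} {A c : ℝ}
    (hk : LocallyIntegrable k) (hK : ∀ ε, 0 < ε → Integrable (K ε))
    (hle : ∀ ε, 0 < ε → ∀ s, ‖K ε s‖ ≤ ‖k s‖)
    (hlim : ∀ s, Filter.Tendsto (fun ε => K ε s) (nhdsWithin 0 (Set.Ioi 0)) (nhds (k s)))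
    (hK' : ∀ ε, 0 < ε → Integrable (K' ε))
    (hA : ∀ ε, 0 < ε → ∫ x, lineConv (K ε) (EuclideanSpace.single i 1) ψ x ^ 2 ≤ A)
    (hA' : ∀ ε, 0 < ε → ∫ x, lineConv (K' ε) (EuclideanSpace.single i 1) ψ x ^ 2 ≤ A)
    (hzero : ∀ ε, ∀ x ∉ box a b, lineConv (K ε) (EuclideanSpace.single i 1) ψ x *
      lineConv (K' ε) (EuclideanSpace.single i 1) ψ x = 0)
    (hc : Filter.Tendsto (fun ε => ∫ x, lineConv (K ε) (EuclideanSpace.single i 1) ψ x *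
      lineConv (K' ε) (EuclideanSpace.single i 1) ψ x) (nhdsWithin 0 (Set.Ioi 0)) (nhds (c * A)))
    (hA0 : 0 ≤ A) :
    c ^ 2 * A ≤ ∫ x, lineConv k (EuclideanSpace.single i 1) ψ x ^ 2 ∂(boxMeasure a b) ∧
      ∫ x, lineConv k (EuclideanSpace.single i 1) ψ x ^ 2 ∂(boxMeasure a b) ≤ A := by
  have hL := tendsto_integral_lineConv_sq (i := i) (ψ := ψ) hk hK hle hlim
  have hbox : ∀ {J : ℝ → ℝ}, Integrable J →
      ∫ x, lineConv J (EuclideanSpace.single i 1) ψ x ^ 2 ∂(boxMeasure a b) ≤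
        ∫ x, lineConv J (EuclideanSpace.single i 1) ψ x ^ 2 := fun hJ =>
    setIntegral_le_integral (memLp_lineConv hJ).integrable_sq
      (Filter.Eventually.of_forall fun x => sq_nonneg _)
  constructor
  · have h1 : (c * A) ^ 2 ≤
        (∫ x, lineConv k (EuclideanSpace.single i 1) ψ x ^ 2 ∂(boxMeasure a b)) * A := by
      refine le_of_tendsto_of_tendsto (hc.pow 2) (hL.mul_const A) ?_
      filter_upwards [self_mem_nhdsWithin] with ε hε
      -- The product lives on the box, so Cauchy–Schwarz can be applied there and involves only the
      -- box energy of `K ε`.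
      rw [← setIntegral_eq_integral_of_forall_compl_eq_zero (s := (box a b : Set E3)) (hzero ε)]
      refine (sq_integral_mul_le ((memLp_lineConv (hK ε hε)).restrict _)
        ((memLp_lineConv (hK' ε hε)).restrict _)).trans ?_
      exact mul_le_mul_of_nonneg_left ((hbox (hK' ε hε)).trans (hA' ε hε))
        (integral_nonneg fun x => sq_nonneg _)
    rcases hA0.eq_or_lt with h0 | h0
    · rw [← h0, mul_zero]
      exact integral_nonneg fun x => sq_nonneg _
    · refine le_of_mul_le_mul_right (le_trans (le_of_eq ?_) h1) h0
      ring
  · refine le_of_tendsto hL ?_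
    filter_upwards [self_mem_nhdsWithin] with ε hε
    exact (hbox (hK ε hε)).trans (hA ε hε)

theorem left_box_energy_bounds (hβ : β < 1) (hn : n ≠ 0) (hα : 0 < α) (hαβ : α = n - (1 - β)) :
    Real.cos (Real.pi * (1 - β)) ^ 2 * (Real.Gamma (1 - β) ^ 2 * partialEnergy α i φ) ≤
        ∫ x, convDeriv (kern β) n i φ x ^ 2 ∂(boxMeasure a b) ∧
      ∫ x, convDeriv (kern β) n i φ x ^ 2 ∂(boxMeasure a b) ≤
        Real.Gamma (1 - β) ^ 2 * partialEnergy α i φ := by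
  simp only [convDeriv_eq_lineConv (locallyIntegrable_kern hβ)]
  refine box_energy_bounds (K := fun ε => dampedKern β ε)
    (K' := fun ε s => dampedKern β ε (-s)) (locallyIntegrable_kern hβ)
    (fun ε hε => integrable_dampedKern hβ hε)
    (fun ε hε s => (norm_dampedKern_le (le_of_lt hε) s).trans (Real.le_norm_self _))
    (fun s => tendsto_dampedKern β s) (fun ε hε => (integrable_dampedKern hβ hε).comp_neg)
    (fun ε hε => integral_left_sq_le φ hβ hn hα.le hαβ hε)
    (fun ε hε => integral_right_sq_le φ hβ hn hα.le hαβ hε) (fun ε x hx => ?_) ?_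
    (mul_nonneg (sq_nonneg _) (partialEnergy_nonneg φ))
  · rw [mul_comm]
    exact left_mul_right_eq_zero hx
  · convert! tendsto_integral_left_mul_right (i := i) φ hβ hn hα hαβ using 2
    · simp only [mul_comm]
    · ring

theorem right_box_energy_bounds (hβ : β < 1) (hn : n ≠ 0) (hα : 0 < α) (hαβ : α = n - (1 - β)) :
    Real.cos (Real.pi * (1 - β)) ^ 2 * (Real.Gamma (1 - β) ^ 2 * partialEnergy α i φ) ≤
        ∫ x, convDeriv (fun s => kern β (-s)) n i φ x ^ 2 ∂(boxMeasure a b) ∧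
      ∫ x, convDeriv (fun s => kern β (-s)) n i φ x ^ 2 ∂(boxMeasure a b) ≤
        Real.Gamma (1 - β) ^ 2 * partialEnergy α i φ := by
  simp only [convDeriv_eq_lineConv (locallyIntegrable_kern_neg hβ)]
  refine box_energy_bounds (K := fun ε s => dampedKern β ε (-s))
    (K' := fun ε => dampedKern β ε) (locallyIntegrable_kern_neg hβ)
    (fun ε hε => (integrable_dampedKern hβ hε).comp_neg)
    (fun ε hε s => (norm_dampedKern_le (le_of_lt hε) (-s)).trans (Real.le_norm_self _))
    (fun s => tendsto_dampedKern β (-s)) (fun ε hε => integrable_dampedKern hβ hε)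
    (fun ε hε => integral_right_sq_le φ hβ hn hα.le hαβ hε)
    (fun ε hε => integral_left_sq_le φ hβ hn hα.le hαβ hε)
    (fun ε x hx => left_mul_right_eq_zero hx) ?_
    (mul_nonneg (sq_nonneg _) (partialEnergy_nonneg φ))
  convert! tendsto_integral_left_mul_right (i := i) φ hβ hn hα hαβ using 2
  ring

end energy

end energy_identities

/-! ### From directional energies to equivalence of the norms -/

section norm_equivalence

open FourierTransform

variable {a b : Fin 3 → ℝ} {α : ℝ}

theorem sobolevSeminorm_sq (hα : 0 < α) (φ : 𝓓(box a b, ℝ)) :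
    sobolevSeminorm a b α hα φ ^ 2 =
      (2 * Real.pi) ^ (2 * α) * ∫ ξ : E3, ‖ξ‖ ^ (2 * α) * ‖𝓕 (toSchwartz φ) ξ‖ ^ 2 := by
  rw [← integral_rpow_mul_norm_fourier_sq]
  exact Real.sq_sqrt (integral_nonneg fun ξ => by positivity)

theorem integrable_sobolevEnergy (hα : 0 < α) (φ : 𝓓(box a b, ℝ)) :
    Integrable fun ξ : E3 => ‖ξ‖ ^ (2 * α) * ‖𝓕 (toSchwartz φ) ξ‖ ^ 2 := by
  have h := memLp_pow_mul_schwartz hα.le (𝓕 (toSchwartz φ))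
  rw [memLp_two_iff_integrable_sq_norm h.1] at h
  refine h.congr (Filter.Eventually.of_forall fun ξ => ?_)
  simp only
  rw [norm_smul, mul_pow, Real.norm_of_nonneg (by positivity),
    ← Real.rpow_mul_natCast (norm_nonneg _), mul_comm α, Nat.cast_ofNat]

theorem abs_rpow_two_pi (α : ℝ) (ξ : E3) (i : Fin 3) :
    |2 * Real.pi * ξ i| ^ (2 * α) = (2 * Real.pi) ^ (2 * α) * |ξ i| ^ (2 * α) := by
  rw [abs_mul, abs_of_pos (by positivity : 0 < 2 * Real.pi),
    Real.mul_rpow (by positivity) (abs_nonneg _)]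

theorem sum_partialEnergy_le (hα : 0 < α) (φ : 𝓓(box a b, ℝ)) :
    ∑ i, partialEnergy α i φ ≤ 3 * sobolevSeminorm a b α hα φ ^ 2 := by
  have h : ∀ i, partialEnergy α i φ ≤ sobolevSeminorm a b α hα φ ^ 2 := by
    intro i
    rw [sobolevSeminorm_sq, partialEnergy, ← integral_const_mul]
    refine integral_mono (integrable_partialEnergy φ hα.le i)
      ((integrable_sobolevEnergy hα φ).const_mul _) fun ξ => ?_
    simp only
    rw [abs_rpow_two_pi α, mul_assoc]
    gcongr
    exact PiLp.norm_apply_le ξ i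
  refine (Finset.sum_le_sum fun i _ => h i).trans (le_of_eq ?_)
  simp

/-- Bound ‖ξ‖² by three times the square of the largest coordinate and raise to the power α. -/
theorem norm_rpow_le_sum (hα : 0 < α) (ξ : E3) :
    ‖ξ‖ ^ (2 * α) ≤ 3 ^ α * ∑ i, |ξ i| ^ (2 * α) := by
  obtain ⟨i, -, hi⟩ := Finset.exists_max_image Finset.univ (fun i => |ξ i|) Finset.univ_nonempty
  have h1 : ‖ξ‖ ^ 2 ≤ 3 * |ξ i| ^ 2 := by
    rw [EuclideanSpace.norm_sq_eq]
    refine (Finset.sum_le_sum (g := fun _ => |ξ i| ^ 2) fun j hj => ?_).trans (by simp)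
    rw [Real.norm_eq_abs]
    exact pow_le_pow_left₀ (abs_nonneg _) (hi j hj) 2
  have e : ∀ t : ℝ, 0 ≤ t → t ^ (2 * α) = (t ^ 2) ^ α := fun t ht => by
    rw [Real.rpow_mul ht]
    norm_num
  calc ‖ξ‖ ^ (2 * α) = (‖ξ‖ ^ 2) ^ α := e _ (norm_nonneg _)
    _ ≤ (3 * |ξ i| ^ 2) ^ α := Real.rpow_le_rpow (by positivity) h1 hα.le
    _ = 3 ^ α * |ξ i| ^ (2 * α) := by
      rw [Real.mul_rpow (by norm_num) (by positivity), ← e _ (abs_nonneg _)]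
    _ ≤ 3 ^ α * ∑ i, |ξ i| ^ (2 * α) := by
      gcongr
      exact Finset.single_le_sum (f := fun i => |ξ i| ^ (2 * α)) (fun j _ => by positivity)
        (Finset.mem_univ i)

theorem sobolevSeminorm_sq_le (hα : 0 < α) (φ : 𝓓(box a b, ℝ)) :
    sobolevSeminorm a b α hα φ ^ 2 ≤ 3 ^ α * ∑ i, partialEnergy α i φ := by
  rw [sobolevSeminorm_sq, ← integral_const_mul]
  simp only [partialEnergy]
  rw [← integral_finsetSum _ fun i _ => integrable_partialEnergy φ hα.le i, ← integral_const_mul]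
  refine integral_mono ((integrable_sobolevEnergy hα φ).const_mul _)
    ((integrable_finsetSum _ fun i _ => integrable_partialEnergy φ hα.le i).const_mul _) fun ξ => ?_
  simp only [abs_rpow_two_pi]
  rw [← Finset.sum_mul, ← Finset.mul_sum]
  have := mul_le_mul_of_nonneg_left (norm_rpow_le_sum hα ξ)
    (by positivity : 0 ≤ (2 * Real.pi) ^ (2 * α) * ‖𝓕 (toSchwartz φ) ξ‖ ^ 2)
  linarith

theorem l2norm_vec_sq {μ : Measure E3} {f : Fin 3 → E3 → ℝ} (h : ∀ i, MemLp (f i) 2 μ) :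
    l2norm μ (fun x => (WithLp.toLp 2 fun i => f i x : E3)) ^ 2 = ∑ i, ∫ x, f i x ^ 2 ∂μ := by
  rw [l2norm, Real.sq_sqrt (integral_nonneg fun x => by positivity),
    ← integral_finsetSum _ fun i _ => (h i).integrable_sq]
  congr 1
  funext x
  simp [EuclideanSpace.norm_sq_eq]

theorem leftSeminorm_sq (φ : 𝓓(box a b, ℝ)) :
    leftSeminorm a b α φ ^ 2 = ∑ i, (1 / Real.Gamma (⌊α⌋₊ + 1 - α)) ^ 2 *
      ∫ x, convDeriv (kern (α - ⌊α⌋₊)) (⌊α⌋₊ + 1) i φ x ^ 2 ∂(boxMeasure a b) := by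
  simp only [← integral_const_mul, ← mul_pow]
  rw [← l2norm_vec_sq fun i => MemLp.const_mul (memLp_convDeriv
    (locallyIntegrable_kern (floor_frac_lt_one α)) (measurable_kern _) φ.contDiff
    φ.hasCompactSupport a b) _]
  change l2norm (boxMeasure a b) (leftGrad a α φ) ^ 2 = _
  congr 1
  refine l2norm_congr ?_
  filter_upwards [ae_mem_box] with x hx
  ext i
  exact leftRL_eq φ.tsupport_subset i hx

theorem rightSeminorm_sq (φ : 𝓓(box a b, ℝ)) :
    rightSeminorm a b α φ ^ 2 = ∑ i, (1 / Real.Gamma (⌊α⌋₊ + 1 - α)) ^ 2 *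
      ∫ x, convDeriv (fun s => kern (α - ⌊α⌋₊) (-s)) (⌊α⌋₊ + 1) i φ x ^ 2 ∂(boxMeasure a b) := by
  -- The sign in the right derivative disappears on squaring.
  have hone : ((-1 : ℝ) ^ (⌊α⌋₊ + 1)) ^ 2 = 1 := by rw [← pow_mul, mul_comm, pow_mul]; simp
  have e : ∀ (i : Fin 3) (x : E3), (1 / Real.Gamma (⌊α⌋₊ + 1 - α)) ^ 2 *
      convDeriv (fun s => kern (α - ⌊α⌋₊) (-s)) (⌊α⌋₊ + 1) i φ x ^ 2 =
      (1 / Real.Gamma (⌊α⌋₊ + 1 - α) * ((-1) ^ (⌊α⌋₊ + 1) *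
        convDeriv (fun s => kern (α - ⌊α⌋₊) (-s)) (⌊α⌋₊ + 1) i φ x)) ^ 2 := by
    intro i x
    rw [mul_pow, mul_pow ((-1 : ℝ) ^ (⌊α⌋₊ + 1)), hone, one_mul]
  simp only [← integral_const_mul, e]
  rw [← l2norm_vec_sq fun i => MemLp.const_mul (MemLp.const_mul (memLp_convDeriv
    (locallyIntegrable_kern_neg (floor_frac_lt_one α))
    ((measurable_kern _).comp measurable_neg) φ.contDiff
    φ.hasCompactSupport a b) _) _]
  change l2norm (boxMeasure a b) (rightGrad b α φ) ^ 2 = _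
  congr 1
  refine l2norm_congr ?_
  filter_upwards [ae_mem_box] with x hx
  ext i
  exact rightRL_eq φ.tsupport_subset i hx

/-- A zero of the cosine would make 1 - (α - ⌊α⌋) a half-odd integer; as it lies in (0, 1] it would
be 1/2, so α = ⌊α⌋ + 1/2. -/
theorem cos_pi_mul_floor_ne_zero (hα : 0 < α) (hα' : ∀ m : ℕ, α ≠ m + 1 / 2) :
    Real.cos (Real.pi * (1 - (α - ⌊α⌋₊))) ≠ 0 := by
  intro h
  obtain ⟨k, hk⟩ := Real.cos_eq_zero_iff.1 h
  have h1 : (1 - (α - ⌊α⌋₊)) = (2 * k + 1) / 2 := by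
    have := Real.pi_ne_zero
    field_simp at hk
    linarith
  have h2 := Nat.floor_le hα.le
  have h3 := Nat.lt_floor_add_one α
  have hk0 : k = 0 := by
    have ha : (-1 : ℝ) < k := by linarith
    have hb : (k : ℝ) < 1 := by linarith
    have ha' : (-1 : ℤ) < k := by exact_mod_cast ha
    have hb' : k < (1 : ℤ) := by exact_mod_cast hb
    omega
  subst hk0
  refine hα' ⌊α⌋₊ ?_
  push_cast at h1
  linarith

theorem fullNorm_le_of_sq_le {S T : Seminorm ℝ 𝓓(box a b, ℝ)} {A : ℝ}
    (h : ∀ φ, S φ ^ 2 ≤ A * T φ ^ 2) (φ : 𝓓(box a b, ℝ)) :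
    fullNorm S φ ≤ Real.sqrt (max 1 A) * fullNorm T φ := by
  -- The maximum with 1 takes care of the L² part, which is the same on both sides.
  rw [fullNorm_apply, fullNorm_apply, ← Real.sqrt_mul (by positivity), mul_add]
  refine Real.sqrt_le_sqrt (add_le_add ?_ ((h φ).trans ?_))
  · exact le_mul_of_one_le_left (sq_nonneg _) (le_max_left _ _)
  · exact mul_le_mul_of_nonneg_right (le_max_right _ _) (sq_nonneg _)

/-- A seminorm built from directional energies that are comparable with the partial Sobolev
energies has the fractional Sobolev space as its closure. -/
theorem equivalentSpaces_sobolev (hα : 0 < α) {S : Seminorm ℝ 𝓓(box a b, ℝ)} {g c : ℝ}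
    (hg : g ≠ 0) (hc : c ≠ 0) {N : Fin 3 → 𝓓(box a b, ℝ) → ℝ}
    (hS : ∀ φ, S φ ^ 2 = ∑ i, (1 / g) ^ 2 * N i φ)
    (hN : ∀ i φ, c ^ 2 * (g ^ 2 * partialEnergy α i φ) ≤ N i φ ∧
      N i φ ≤ g ^ 2 * partialEnergy α i φ) :
    EquivalentSpaces S (sobolevSeminorm a b α hα) := by
  have hup : ∀ φ, S φ ^ 2 ≤ ∑ i, partialEnergy α i φ := fun φ => by
    rw [hS]
    refine Finset.sum_le_sum fun i _ => ?_
    rw [one_div, inv_pow, inv_mul_le_iff₀ (by positivity)]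
    exact (hN i φ).2
  have hlow : ∀ φ, c ^ 2 * ∑ i, partialEnergy α i φ ≤ S φ ^ 2 := fun φ => by
    rw [hS, Finset.mul_sum]
    refine Finset.sum_le_sum fun i _ => ?_
    rw [one_div, inv_pow, le_inv_mul_iff₀ (by positivity)]
    refine le_trans (le_of_eq ?_) (hN i φ).1
    ring
  refine equivalentSpaces_of_le (injective_toL2_sobolev hα)
    -- The factor 3^α comes from comparing ‖ξ‖ with its coordinates, and c⁻² from the lower bound on
    -- the box; the 3 in the opposite direction counts the coordinates.
    (fullNorm_le_of_sq_le (A := 3 ^ α * (c ^ 2)⁻¹) fun φ => ?_)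
    (fullNorm_le_of_sq_le (A := 3) fun φ => (hup φ).trans (sum_partialEnergy_le hα φ))
  refine (sobolevSeminorm_sq_le hα φ).trans ?_
  rw [mul_assoc]
  gcongr
  rw [le_inv_mul_iff₀ (by positivity)]
  exact hlow φ

end norm_equivalence

end FracSobolev

end

theorem theorem2p1 (a b : Fin 3 → ℝ) (hab : ∀ i, a i < b i) (α : ℝ) (hα : 0 < α)
    (hα' : ∀ m : ℕ, α ≠ m + 1 / 2) :
    FracSobolev.EquivalentSpaces (FracSobolev.leftSeminorm a b α)
        (FracSobolev.sobolevSeminorm a b α hα) ∧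
      FracSobolev.EquivalentSpaces (FracSobolev.rightSeminorm a b α)
        (FracSobolev.sobolevSeminorm a b α hα) := by
  have hβ := FracSobolev.floor_frac_lt_one α
  have hγ : (⌊α⌋₊ + 1 - α : ℝ) = 1 - (α - ⌊α⌋₊) := by ring
  have hg : Real.Gamma (⌊α⌋₊ + 1 - α) ≠ 0 := (Real.Gamma_pos_of_pos (by linarith)).ne'
  have hc := FracSobolev.cos_pi_mul_floor_ne_zero hα hα'
  -- This is α = n - γ: n derivatives against a kernel that integrates to order γ = 1 - β.
  have hn : α = ((⌊α⌋₊ + 1 : ℕ) : ℝ) - (1 - (α - ⌊α⌋₊)) := by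
    push_cast
    ring
  constructor
  · refine FracSobolev.equivalentSpaces_sobolev hα hg hc FracSobolev.leftSeminorm_sq fun i φ => ?_
    rw [hγ]
    exact FracSobolev.left_box_energy_bounds φ hβ (Nat.succ_ne_zero _) hα hn
  · refine FracSobolev.equivalentSpaces_sobolev hα hg hc FracSobolev.rightSeminorm_sq fun i φ => ?_
    rw [hγ]
    exact FracSobolev.right_box_energy_bounds φ hβ (Nat.succ_ne_zero _) hα hn
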